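/- **Gibbs QSample preparation.** For a Hamiltonian $H:\Omega\to\{0,\dots,n\}$ on a finite set $\Omega$ with $|\Omega|\ge 2$, $n\ge 2$, let $\mu_\beta(x)=e^{-\beta H(x)}/\sum_{y\in\Omega}e^{-\beta H(y)}$ be the Gibbs distribution at inverse temperature $\beta\ge 0$. For a probability distribution $\pi$ on $\Omega$ write $|\pi\rangle=\sum_{x\in\Omega}\sqrt{\pi(x)}\,|x\rangle$. For pure states let $D_{\mathrm{tr}}(|a\rangle,|b\rangle)=\sqrt{1-|\langle a|b\rangle|^2}$. Put $s=\sqrt{\ln|\Omega|\,\ln n}$. For a transition matrix $P$ on $\Omega$ let $T|x\rangle=\sum_{y}\sqrt{P(x,y)}\,|x\rangle|y\rangle$, let $S|x\rangle|y\rangle=|y\rangle|x\rangle$, let $W=(2TT^\dagger-I)S$ be the qubitized Szegedy walk on $\mathbb C^{\Omega}\otimes\mathbb C^{\Omega}$, and let $\Delta_W=\min\{|\theta|:\theta\in\mathbb R\setminus\{0\},\,e^{i\theta}\in\mathrm{spec}(W)\}$ be its phase gap. Let $|0\rangle$ denote a fixed basis state of an $\Omega$-register. A query oracle for $P$ is any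 unitary $O$ on $\mathbb C^{\Omega}\otimes\mathbb C^{\Omega}$ with $O|x\rangle|0\rangle=\sum_y\sqrt{P(x,y)}\,|x\rangle|y\rangle$ for all $x\in\Omega$ (its action on the other basis states is arbitrary). A query is a use of an oracle or of its adjoint. Circuits act on one additional qubit and two $\Omega$-registers, that is, on $\mathbb C^2\otimes\mathbb C^{\Omega}\otimes\mathbb C^{\Omega}$. They are finite sequences of the following gates: arbitrary unitaries on the qubit; the swap $S$ of the two registers, and the reflection $2|0\rangle\langle 0|-I$ in the second register, each controlled by the qubit; and queries to the available oracles (acting on the two registers). There are a universal constant $C>0$ and circuits $A_{\ell,\Delta,\varepsilon}$ with $\ell+1$ oracle slots, depending only on $\ell\in\mathbb N$ and $\Delta,\varepsilon\in\mathbb R$ (in particular not on $H$, the temperatures, the Markov chains or the oracles), such that for all $\Omega,n,H$ as above and every target inverse temperature $\beta^*>0$ the following holds. There is a cooling schedule $0=\beta_0<\beta_1<\dots<\beta_\ell=\beta^*$ with $\ell\le C\,s$ and $|\langle\mu_{\beta_i}|\mu_{\beta_{i+1}}\rangle|^2\ge\frac1{15}$ for $0\le i<\ell$. Moreover, let $P_0,\dots,P_\ell$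 be any irreducible transition matrices on $\Omega$ such that $P_i$ is reversible with respect to $\mu_{\beta_i}$ (so that $\mu_{\beta_i}$ is its stationary distribution), with walks $W_i$; put $\Delta_{\min}=\min_{0\le i\le\ell}\Delta_{W_i}$; let $O_0,\dots,O_\ell$ be any query oracles for $P_0,\dots,P_\ell$; and let $\varepsilon\in(0,1)$. Then the circuit $A_{\ell,\Delta_{\min},\varepsilon}$ with these oracles, run on the initial state $|0\rangle|\mu_{\beta_0}\rangle|0\rangle$, outputs a state within trace distance $D_{\mathrm{tr}}\le\varepsilon$ of $|0\rangle|\mu_{\beta_\ell}\rangle|0\rangle$, and it makes at most $$C\,\frac{s}{\Delta_{\min}}\,\Bigl(\ln\bigl(2+\tfrac{s}{\varepsilon}\bigr)\Bigr)^2=\widetilde{\mathcal O}\!\left(\frac{\sqrt{\ln|\Omega|\,\ln n}}{\Delta_{\min}}\right)$$ queries. -/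

import Mathlib

open scoped Matrix Kronecker

noncomputable section

namespace QSample

variable {Ω : Type*} [Fintype Ω] [DecidableEq Ω]

/-- Partition function `Z(β) = ∑ₓ exp(-β H(x))` of a classical Hamiltonian. -/
def partitionFunction (H : Ω → ℝ) (β : ℝ) : ℝ := ∑ x, Real.exp (-β * H x)

/-- Gibbs distribution `μ_β(x) = exp(-β H(x)) / Z(β)`. -/
def gibbs (H : Ω → ℝ) (β : ℝ) (x : Ω) : ℝ := Real.exp (-β * H x) / partitionFunction H β

/-- Gibbs distribution of an integer-valued Hamiltonian `H : Ω → {0, …, n}`. -/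
def intGibbs {n : ℕ} (H : Ω → Fin (n + 1)) (β : ℝ) : Ω → ℝ := gibbs (fun x => ((H x : ℕ) : ℝ)) β

/-- The quantity `√(ln |Ω| · ln n)`. -/
def annealingScale (Ω : Type*) [Fintype Ω] (n : ℕ) : ℝ :=
  √(Real.log (Fintype.card Ω) * Real.log n)

/-- The quantum sample `|π⟩ = ∑ₓ √π(x) |x⟩`. -/
def qsample (π : Ω → ℝ) : EuclideanSpace ℂ Ω := WithLp.toLp 2 fun x => ((√(π x) : ℝ) : ℂ)

/-- Trace distance of two pure states, `√(1 - |⟨α|β⟩|²)`. -/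
def traceDist {ι : Type*} [Fintype ι] (α β : EuclideanSpace ℂ ι) : ℝ :=
  √(1 - ‖inner ℂ α β‖ ^ 2)

/-- `P` is the transition matrix of an irreducible Markov chain that is reversible with respect
to `π` (so that `π` is its unique stationary distribution). -/
structure IsReversibleChain (P : Matrix Ω Ω ℝ) (π : Ω → ℝ) : Prop where
  stochastic : P ∈ Matrix.rowStochastic ℝ Ω
  irreducible : P.IsIrreducible
  detailed_balance : ∀ x y, π x * P x y = π y * P y x

/-- The quantum step isometry `T : |x⟩ ↦ |x⟩ |P(x,·)⟩`, `|P(x,·)⟩ = ∑_y √P(x,y) |y⟩`. -/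
def stepIsometry (P : Matrix Ω Ω ℝ) : Matrix (Ω × Ω) Ω ℂ :=
  Matrix.of fun p x => if p.1 = x then ((√(P x p.2) : ℝ) : ℂ) else 0

/-- The swap operator `S |x⟩|y⟩ = |y⟩|x⟩`. -/
def swapMatrix (Ω : Type*) [DecidableEq Ω] : Matrix (Ω × Ω) (Ω × Ω) ℂ :=
  Matrix.of fun p q => if p = q.swap then 1 else 0

/-- The qubitized Szegedy walk `W = (2 T T† - I) S`. -/
def szegedyWalk (P : Matrix Ω Ω ℝ) : Matrix (Ω × Ω) (Ω × Ω) ℂ :=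
  ((2 : ℂ) • (stepIsometry P * (stepIsometry P)ᴴ) - 1) * swapMatrix Ω

/-- The phase gap `min {|θ| : θ ≠ 0, e^{iθ} ∈ spec W}` of the walk of `P`. -/
def phaseGap (P : Matrix Ω Ω ℝ) : ℝ :=
  sInf {r : ℝ | ∃ θ : ℝ, θ ≠ 0 ∧
    Complex.exp (θ * Complex.I) ∈ spectrum ℂ (szegedyWalk P) ∧ r = |θ|}

/-- The smallest phase gap `Δ_min = min_i Δ_{W_i}` of a finite sequence of chains. -/
def minPhaseGap {m : ℕ} (P : Fin m → Matrix Ω Ω ℝ) : ℝ := ⨅ i, phaseGap (P i)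

/-- `O` is a query oracle for `P`, with `z` the label of the basis state `|0⟩` of a register: a
unitary with `O |x⟩|0⟩ = ∑_y √P(x,y) |x⟩|y⟩`. Its action on other basis states is arbitrary. -/
def IsOracle (P : Matrix Ω Ω ℝ) (z : Ω) (O : Matrix (Ω × Ω) (Ω × Ω) ℂ) : Prop :=
  O ∈ Matrix.unitaryGroup (Ω × Ω) ℂ ∧
    ∀ x x' y, O (x', y) (x, z) = if x' = x then ((√(P x y) : ℝ) : ℂ) else 0

/-- The reflection `I ⊗ (2|0⟩⟨0| - I)` about `|0⟩` in the second register. -/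
def reflectZero (z : Ω) : Matrix (Ω × Ω) (Ω × Ω) ℂ :=
  (1 : Matrix Ω Ω ℂ) ⊗ₖ ((2 : ℂ) • Matrix.single z z (1 : ℂ) - 1)

/-- The operator `|0⟩⟨0| ⊗ I + |1⟩⟨1| ⊗ M`: `M` controlled by the additional qubit. -/
def controlled (M : Matrix (Ω × Ω) (Ω × Ω) ℂ) :
    Matrix (Fin 2 × Ω × Ω) (Fin 2 × Ω × Ω) ℂ :=
  Matrix.single (0 : Fin 2) 0 (1 : ℂ) ⊗ₖ (1 : Matrix (Ω × Ω) (Ω × Ω) ℂ)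
    + Matrix.single (1 : Fin 2) 1 (1 : ℂ) ⊗ₖ M

/-- The gates of a circuit with access to `m` oracles `O_i` and their adjoints. Apart from the
oracle calls, only unitaries on the additional qubit, and the swap of the two registers and the
reflection about `|0⟩` in the second register, both controlled by that qubit, are available. -/
inductive Gate (m : ℕ) : Type
  | qubit (u : Matrix.unitaryGroup (Fin 2) ℂ)
  | cswap
  | creflect
  | oracle (i : Fin m)
  | oracleAdj (i : Fin m)

/-- The unitary of a gate on one qubit and two `Ω`-registers, `ℂ² ⊗ ℂ^Ω ⊗ ℂ^Ω`. -/
def Gate.toMatrix {m : ℕ} (z : Ω) (O : Fin m → Matrix (Ω × Ω) (Ω × Ω) ℂ) :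
    Gate m → Matrix (Fin 2 × Ω × Ω) (Fin 2 × Ω × Ω) ℂ
  | .qubit u => (u : Matrix (Fin 2) (Fin 2) ℂ) ⊗ₖ (1 : Matrix (Ω × Ω) (Ω × Ω) ℂ)
  | .cswap => controlled (swapMatrix Ω)
  | .creflect => controlled (reflectZero z)
  | .oracle i => (1 : Matrix (Fin 2) (Fin 2) ℂ) ⊗ₖ O i
  | .oracleAdj i => (1 : Matrix (Fin 2) (Fin 2) ℂ) ⊗ₖ (O i)ᴴ

/-- The number of queries (uses of some `O_i` or `O_i†`) made by a gate. -/
def Gate.queries {m : ℕ} : Gate m → ℕ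
  | .oracle _ => 1
  | .oracleAdj _ => 1
  | _ => 0

/-- A circuit is a list of gates, applied from left to right. -/
abbrev Circuit (m : ℕ) : Type := List (Gate m)

/-- The query complexity of a circuit. -/
def Circuit.queries {m : ℕ} (c : Circuit m) : ℕ := (List.map Gate.queries c).sum

/-- The output state of a circuit on a given input state. -/
def Circuit.run {m : ℕ} (c : Circuit m) (z : Ω) (O : Fin m → Matrix (Ω × Ω) (Ω × Ω) ℂ)
    (ψ : EuclideanSpace ℂ (Fin 2 × Ω × Ω)) : EuclideanSpace ℂ (Fin 2 × Ω × Ω) :=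
  List.foldl (fun φ g => Matrix.toEuclideanLin (Gate.toMatrix z O g) φ) ψ c

/-- The clean state `|0⟩ ⊗ |ψ⟩ ⊗ |0⟩`. -/
def cleanState (z : Ω) (ψ : EuclideanSpace ℂ Ω) : EuclideanSpace ℂ (Fin 2 × Ω × Ω) :=
  WithLp.toLp 2 fun p => if p.1 = 0 ∧ p.2.2 = z then ψ p.2.1 else 0

end QSample

end

set_option linter.unusedSectionVars false

namespace QSample

/-! ### Cooling schedules with constant overlaps -/

section Schedule

variable {Ω : Type*} [Fintype Ω]

/-! Schedule. Let `F = log Z` and let `E = -F'` be the mean energy. The squared overlap of the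
samples at `a < b` is `exp (-c)` with `c = F a + F b - 2 F ((a + b) / 2)`. The tangent lines of the
convex function `F` at `a` and `b`, read off at the midpoint, give `c ≤ (F a - F b) * log (E a / E
b)` (`logGap_le_mul_log_div`). A greedy schedule takes `c = log 2` in every step. By Cauchy-Schwarz
the number of steps is then bounded by the square root of the total drop of `F` times the total drop
of `log E`, hence by a multiple of `s`. Once `E ≤ 1/4` the ground states dominate and a single jump
reaches the target (`exists_schedule_from`).

Algorithm. Each stage moves one sample to the next by the π/3 fixed-point amplification `U ↦ U Rs U†
Rt U`, which cubes the norm of the component off the target (`norm_amplify`). The selective phase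
shifts `Rs`, `Rt` come from the walks. If `ψ` is orthogonal to `|π⟩`, then `Tψ` is orthogonal to
every fixed vector of `W` (`inner_fixed_stepIsometry`), so it is a sum of eigenvectors whose phases
are at least the gap `Δ`. One qubit tells these from `T|π⟩`: `O(1/Δ)` small rotations, interleaved
with controlled walks, add up to a quarter turn on fixed vectors but are ineffective off resonance
(`norm_rabiFilter_le`). The same amplification, now acting on the qubit, suppresses the failure
amplitude from `√(1/2)` to `√(1/2) ^ 3 ^ k` and is exact on fixed vectors (`norm_phaseFilter`).
Shifting the phase of the qubit state `|0⟩` between the filter and its inverse approximates the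
selective phase shift (`phaseShiftCircuit_approx`).

Both amplifications use `3 ^ k` of order `log (2 + l / ε)`; this gives total error `ε` and the two
logarithms of the query bound. -/

theorem partitionFunction_pos [Nonempty Ω] (h : Ω → ℝ) (β : ℝ) : 0 < partitionFunction h β :=
  Finset.sum_pos (fun _ _ => Real.exp_pos _) Finset.univ_nonempty

theorem gibbs_pos [Nonempty Ω] (h : Ω → ℝ) (β : ℝ) (x : Ω) : 0 < gibbs h β x :=
  div_pos (Real.exp_pos _) (partitionFunction_pos h β)

theorem sum_gibbs [Nonempty Ω] (h : Ω → ℝ) (β : ℝ) : ∑ x, gibbs h β x = 1 := by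
  simp only [gibbs, ← Finset.sum_div]
  exact div_self (partitionFunction_pos h β).ne'

theorem gibbs_sub_const (h : Ω → ℝ) (c β : ℝ) : gibbs (fun x => h x - c) β = gibbs h β := by
  funext x
  have e : ∀ y, Real.exp (-β * (h y - c)) = Real.exp (β * c) * Real.exp (-β * h y) := fun y => by
    rw [← Real.exp_add]; ring_nf
  simp only [gibbs, partitionFunction, e, ← Finset.mul_sum]
  exact mul_div_mul_left _ _ (Real.exp_pos _).ne'

/-- The negative logarithm of the squared overlap of two Gibbs quantum samples. -/
noncomputable def logGap (h : Ω → ℝ) (a b : ℝ) : ℝ :=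
  Real.log (partitionFunction h a) + Real.log (partitionFunction h b)
    - 2 * Real.log (partitionFunction h ((a + b) / 2))

/-- The mean energy of the Gibbs distribution. -/
noncomputable def meanEnergy (h : Ω → ℝ) (β : ℝ) : ℝ := ∑ x, gibbs h β x * h x

theorem inner_qsample (p q : Ω → ℝ) :
    inner ℂ (qsample p) (qsample q) = ((∑ x, √(p x) * √(q x) : ℝ) : ℂ) := by
  simp [qsample, PiLp.inner_apply, mul_comm]

/-- The geometric mean of two Boltzmann weights is the Boltzmann weight at the mean temperature, so
the overlap is a midpoint partition function over a geometric mean of partition functions. -/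
theorem norm_inner_qsample_gibbs_sq [Nonempty Ω] (h : Ω → ℝ) (a b : ℝ) :
    ‖inner ℂ (qsample (gibbs h a)) (qsample (gibbs h b))‖ ^ 2 = Real.exp (-logGap h a b) := by
  have hZ := partitionFunction_pos h
  have e : ∀ x, √(gibbs h a x) * √(gibbs h b x) =
      Real.exp (-((a + b) / 2) * h x) / √(partitionFunction h a * partitionFunction h b) := by
    intro x
    rw [← Real.sqrt_mul (gibbs_pos h a x).le, gibbs, gibbs, div_mul_div_comm, ← Real.exp_add,
      Real.sqrt_div (Real.exp_pos _).le,
      show -a * h x + -b * h x = -((a + b) / 2) * h x + -((a + b) / 2) * h x by ring, Real.exp_add,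
      Real.sqrt_mul_self (Real.exp_pos _).le]
  rw [inner_qsample, Complex.norm_real, Real.norm_eq_abs, sq_abs]
  simp only [e, ← Finset.sum_div]
  rw [div_pow, Real.sq_sqrt (mul_pos (hZ a) (hZ b)).le, logGap, neg_sub, Real.exp_sub, two_mul,
    Real.exp_add, Real.exp_add, Real.exp_log (hZ _), Real.exp_log (hZ _), Real.exp_log (hZ _), sq]
  rfl

/-- Tangent-line inequality for the convex function `log Z`, whose slope is minus the mean energy;
it is Jensen's inequality for `exp` under the Gibbs weights. -/
theorem neg_mul_meanEnergy_le [Nonempty Ω] (h : Ω → ℝ) (a d : ℝ) :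
    -d * meanEnergy h a ≤
      Real.log (partitionFunction h (a + d)) - Real.log (partitionFunction h a) := by
  have hZ := partitionFunction_pos h
  have J := convexOn_exp.map_sum_le (t := Finset.univ) (w := gibbs h a) (p := fun x => -d * h x)
    (fun x _ => (gibbs_pos h a x).le) (sum_gibbs h a) (fun _ _ => Set.mem_univ _)
  have e1 : ∑ x, gibbs h a x • (-d * h x) = -d * meanEnergy h a := by
    rw [meanEnergy, Finset.mul_sum]
    exact Finset.sum_congr rfl fun x _ => by simp only [smul_eq_mul]; ring
  have e2 : ∑ x, gibbs h a x • Real.exp (-d * h x) =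
      partitionFunction h (a + d) / partitionFunction h a := by
    rw [partitionFunction, Finset.sum_div]
    refine Finset.sum_congr rfl fun x _ => ?_
    rw [smul_eq_mul, gibbs, div_mul_eq_mul_div, ← Real.exp_add]
    ring_nf
  rw [e1, e2] at J
  rw [← Real.log_div (hZ _).ne' (hZ _).ne']
  exact (Real.le_log_iff_exp_le (div_pos (hZ _) (hZ _))).2 J

theorem continuous_logGap [Nonempty Ω] (h : Ω → ℝ) (a : ℝ) : Continuous (logGap h a) := by
  have hc : Continuous (partitionFunction h) := by
    unfold partitionFunction
    fun_prop
  have hl : Continuous fun b => Real.log (partitionFunction h b) :=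
    hc.log fun b => (partitionFunction_pos h b).ne'
  exact (continuous_const.add hl).sub
    (continuous_const.mul (hl.comp (by fun_prop : Continuous fun b : ℝ => (a + b) / 2)))

theorem partitionFunction_antitone {h : Ω → ℝ} (h0 : ∀ x, 0 ≤ h x) :
    Antitone (partitionFunction h) := fun a b hab =>
  Finset.sum_le_sum fun x _ => Real.exp_le_exp.2 (by nlinarith [h0 x])

/-- Makes the greedy schedule terminate: a step of gap `log 2` lowers `log Z` by at least `log 2`.
-/
theorem logGap_le_log_sub_log [Nonempty Ω] {h : Ω → ℝ} (h0 : ∀ x, 0 ≤ h x) {a b : ℝ} (hab : a ≤ b) :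
    logGap h a b ≤ Real.log (partitionFunction h a) - Real.log (partitionFunction h b) := by
  have := Real.log_le_log (partitionFunction_pos h b)
    (partitionFunction_antitone h0 (show (a + b) / 2 ≤ b by linarith))
  unfold logGap
  linarith

/-- A cooling step of fixed overlap loses a definite amount of `log Z` times `log E`. -/
theorem logGap_le_mul_log_div [Nonempty Ω] {h : Ω → ℝ} {a b : ℝ} (hab : a < b)
    (hc : 0 < logGap h a b) (hb : 0 < meanEnergy h b) :
    logGap h a b ≤ (Real.log (partitionFunction h a) - Real.log (partitionFunction h b)) *
      Real.log (meanEnergy h a / meanEnergy h b) := by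
  have J1 := neg_mul_meanEnergy_le h a ((b - a) / 2)
  have J2 := neg_mul_meanEnergy_le h b (-((b - a) / 2))
  rw [show a + (b - a) / 2 = (a + b) / 2 by ring] at J1
  rw [show b + -((b - a) / 2) = (a + b) / 2 by ring] at J2
  set c := logGap h a b with hcdef
  set d := Real.log (partitionFunction h a) - Real.log (partitionFunction h b) with hd
  have hδ : 0 < (b - a) / 2 := by linarith
  -- `(d + c) / 2` and `(d - c) / 2` are the drops of `log Z` over the first and second half of `[a,
  -- b]`.
  have k1 : (d + c) / 2 ≤ (b - a) / 2 * meanEnergy h a := by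
    simp only [hd, hcdef, logGap]; linarith
  have k2 : (b - a) / 2 * meanEnergy h b ≤ (d - c) / 2 := by
    simp only [hd, hcdef, logGap]; linarith
  have k3 : 0 < (b - a) / 2 * meanEnergy h b := mul_pos hδ hb
  have hdc : c < d := by linarith
  have hA : 0 < meanEnergy h a := by
    by_contra hh
    nlinarith
  have hl := Real.one_sub_inv_le_log_of_pos (div_pos hA hb)
  have hr : meanEnergy h b / meanEnergy h a ≤ (d - c) / (d + c) := by
    rw [← mul_div_mul_left (meanEnergy h b) _ hδ.ne', div_le_div_iff₀ (mul_pos hδ hA) (by linarith)]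
    nlinarith
  rw [inv_div] at hl
  -- The right side is `2c / (d + c)`, and `c < d`.
  have h2 : c / d ≤ 1 - (d - c) / (d + c) := by
    rw [one_sub_div (by linarith), div_le_div_iff₀ (by linarith) (by linarith)]
    nlinarith
  calc c = d * (c / d) := (mul_div_cancel₀ _ (by linarith)).symm
    _ ≤ _ := mul_le_mul_of_nonneg_left (by linarith) (by linarith)

/-- By Markov's inequality the states with `h ≥ 1` have mass at most `1/4` at `a`. The weight of the
ground states does not depend on the temperature, so cooling at most halves `Z`. -/
theorem logGap_le_of_meanEnergy_le [Nonempty Ω] {h : Ω → ℝ} (h01 : ∀ x, h x = 0 ∨ 1 ≤ h x)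
    {a b : ℝ} (hab : a ≤ b) (ha : meanEnergy h a ≤ 1 / 4) : logGap h a b ≤ Real.log 2 := by
  classical
  have hZ := partitionFunction_pos h
  have h0 : ∀ x, 0 ≤ h x := fun x => (h01 x).elim (fun e => e.ge) (by intro; linarith)
  have k1 : partitionFunction h a - ∑ x, (if h x = 0 then (1 : ℝ) else 0) ≤
      partitionFunction h a * meanEnergy h a := by
    rw [partitionFunction, ← Finset.sum_sub_distrib, meanEnergy, Finset.mul_sum]
    refine Finset.sum_le_sum fun x _ => ?_
    rw [gibbs, ← partitionFunction, ← mul_assoc, mul_div_cancel₀ _ (hZ a).ne']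
    rcases h01 x with e | e
    · simp [e]
    · rw [if_neg (by linarith)]
      nlinarith [Real.exp_pos (-a * h x)]
  have k2 : ∑ x, (if h x = 0 then (1 : ℝ) else 0) ≤ partitionFunction h ((a + b) / 2) := by
    refine Finset.sum_le_sum fun x _ => ?_
    split_ifs with e
    · simp [e]
    · positivity
  have k3 := partitionFunction_antitone h0 (show (a + b) / 2 ≤ b by linarith)
  have k4 : partitionFunction h a ≤ 2 * partitionFunction h ((a + b) / 2) := by
    nlinarith [hZ a]
  have l1 := Real.log_le_log (hZ _) k4
  rw [Real.log_mul two_ne_zero (hZ _).ne'] at l1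
  have l2 := Real.log_le_log (hZ _) k3
  unfold logGap
  linarith

/-- Cauchy-Schwarz in the plane, in the form that adds one schedule step at a time to a bound of
type `√(x * y)`. -/
theorem sqrt_mul_add_sqrt_le {a b c d : ℝ} (ha : 0 ≤ a) (hb : 0 ≤ b) (hc : 0 ≤ c) (hd : 0 ≤ d) :
    √(a * b) + √(c * d) ≤ √((a + c) * (b + d)) := by
  apply Real.le_sqrt_of_sq_le
  have e : √(a * b) * √(c * d) = √(a * d) * √(c * b) := by
    rw [← Real.sqrt_mul (by positivity), ← Real.sqrt_mul (by positivity)]; ring_nf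
  nlinarith [Real.sq_sqrt (mul_nonneg ha hb), Real.sq_sqrt (mul_nonneg hc hd),
    Real.sq_sqrt (mul_nonneg ha hd), Real.sq_sqrt (mul_nonneg hc hb),
    sq_nonneg (√(a * d) - √(c * b))]

/-- The number `k` is fuel for the induction, spent one unit per greedy step. The summand `2` pays
for the final jumps, which need not make progress in `log Z` and `log E`. -/
theorem exists_schedule_from [Nonempty Ω] {h : Ω → ℝ} (h01 : ∀ x, h x = 0 ∨ 1 ≤ h x) (B : ℝ)
    (k : ℕ) : ∀ a < B,
    Real.log (partitionFunction h a) - Real.log (partitionFunction h B) < k * Real.log 2 →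
    ∃ (l : ℕ) (β : Fin (l + 1) → ℝ), StrictMono β ∧ β 0 = a ∧ β (Fin.last l) = B ∧
      (∀ i : Fin l, logGap h (β i.castSucc) (β i.succ) ≤ Real.log 2) ∧
      (l : ℝ) ≤ 2 + √((Real.log (partitionFunction h a) - Real.log (partitionFunction h B)) *
        Real.log (4 * meanEnergy h a) / Real.log 2) := by
  have hZ := partitionFunction_pos h
  have h0 : ∀ x, 0 ≤ h x := fun x => (h01 x).elim (fun e => e.ge) (by intro; linarith)
  have hl2 : 0 < Real.log 2 := Real.log_pos one_lt_two
  have one_step : ∀ a < B, logGap h a B ≤ Real.log 2 → ∃ β : Fin (1 + 1) → ℝ,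
      StrictMono β ∧ β 0 = a ∧ β (Fin.last 1) = B ∧
      (∀ i : Fin 1, logGap h (β i.castSucc) (β i.succ) ≤ Real.log 2) := by
    intro a ha hg
    refine ⟨![a, B], ?_, rfl, rfl, ?_⟩
    · rw [Fin.strictMono_iff_lt_succ]
      intro i
      fin_cases i
      simpa using ha
    · intro i
      fin_cases i
      simpa using hg
  have cons_step : ∀ a b (l : ℕ) (β : Fin (l + 1) → ℝ), a < b → logGap h a b ≤ Real.log 2 →
      StrictMono β → β 0 = b → β (Fin.last l) = B →
      (∀ i : Fin l, logGap h (β i.castSucc) (β i.succ) ≤ Real.log 2) →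
      ∃ β' : Fin (l + 1 + 1) → ℝ, StrictMono β' ∧ β' 0 = a ∧ β' (Fin.last (l + 1)) = B ∧
      (∀ i : Fin (l + 1), logGap h (β' i.castSucc) (β' i.succ) ≤ Real.log 2) := by
    intro a b l β hab hg hm hb hB hs
    refine ⟨Fin.cons a β, ?_, rfl, ?_, ?_⟩
    · rw [Fin.strictMono_iff_lt_succ]
      intro i
      refine Fin.cases ?_ (fun j => ?_) i
      · simpa [hb] using hab
      · rw [← Fin.succ_castSucc, Fin.cons_succ, Fin.cons_succ]
        exact hm (Fin.castSucc_lt_succ)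
    · rw [← Fin.succ_last, Fin.cons_succ, hB]
    · intro i
      refine Fin.cases ?_ (fun j => ?_) i
      · simpa [hb] using hg
      · rw [← Fin.succ_castSucc, Fin.cons_succ, Fin.cons_succ]
        exact hs j
  induction k with
  | zero =>
    intro a ha hF
    have := Real.log_le_log (hZ _) (partitionFunction_antitone h0 ha.le)
    simp at hF
    linarith
  | succ k ih =>
    intro a ha hF
    by_cases hj : logGap h a B ≤ Real.log 2
    · obtain ⟨β, h1, h2, h3, h4⟩ := one_step a ha hj
      refine ⟨1, β, h1, h2, h3, h4, ?_⟩
      have := Real.sqrt_nonneg ((Real.log (partitionFunction h a) -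
        Real.log (partitionFunction h B)) * Real.log (4 * meanEnergy h a) / Real.log 2)
      push_cast
      linarith
    push Not at hj
    have hEa : 1 / 4 < meanEnergy h a := by
      by_contra hh
      exact absurd (logGap_le_of_meanEnergy_le h01 ha.le (not_lt.1 hh)) (not_le.2 hj)
    have haa : logGap h a a = 0 := by
      unfold logGap
      rw [add_self_div_two]
      ring
    -- The gap is made exactly `log 2`: small enough for the overlap, large enough to force
    -- progress.
    obtain ⟨b, ⟨hab, hbB⟩, hb⟩ := intermediate_value_Ioo ha.le (continuous_logGap h a).continuousOn
      (show Real.log 2 ∈ Set.Ioo (logGap h a a) (logGap h a B) from ⟨by rwa [haa], hj⟩)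
    have hdrop := logGap_le_log_sub_log h0 hab.le
    rw [hb] at hdrop
    by_cases hEb : meanEnergy h b ≤ 1 / 4
    · obtain ⟨β, h1, h2, h3, h4⟩ := one_step b hbB (logGap_le_of_meanEnergy_le h01 hbB.le hEb)
      obtain ⟨β', g1, g2, g3, g4⟩ := cons_step a b 1 β hab hb.le h1 h2 h3 h4
      refine ⟨2, β', g1, g2, g3, g4, ?_⟩
      have := Real.sqrt_nonneg ((Real.log (partitionFunction h a) -
        Real.log (partitionFunction h B)) * Real.log (4 * meanEnergy h a) / Real.log 2)
      push_cast
      linarith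
    push Not at hEb
    obtain ⟨l, β, h1, h2, h3, h4, h5⟩ := ih b hbB (by push_cast at hF; linarith)
    obtain ⟨β', g1, g2, g3, g4⟩ := cons_step a b l β hab hb.le h1 h2 h3 h4
    refine ⟨l + 1, β', g1, g2, g3, g4, ?_⟩
    have hm := logGap_le_mul_log_div hab (by rwa [hb]) (by linarith)
    rw [hb] at hm
    have hFb := Real.log_le_log (hZ _) (partitionFunction_antitone h0 hbB.le)
    set Fa := Real.log (partitionFunction h a)
    set Fb := Real.log (partitionFunction h b)
    set FB := Real.log (partitionFunction h B)
    have hg : Real.log (meanEnergy h a / meanEnergy h b) =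
        Real.log (4 * meanEnergy h a) - Real.log (4 * meanEnergy h b) := by
      rw [← Real.log_div (by linarith) (by linarith), mul_div_mul_left _ _ (by norm_num)]
    have hgb : 0 ≤ Real.log (4 * meanEnergy h b) := Real.log_nonneg (by linarith)
    have hgp : 0 ≤ Real.log (meanEnergy h a / meanEnergy h b) := by
      by_contra hh
      push Not at hh
      nlinarith
    have S := sqrt_mul_add_sqrt_le (sub_nonneg.2 hFb)
      (div_nonneg hgb hl2.le) (show 0 ≤ Fa - Fb by linarith) (div_nonneg hgp hl2.le)
    -- The new step contributes at least `1` to the square-root bound; superadditivity `S` merges it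
    -- with the bound for the rest.
    have S1 : 1 ≤ √((Fa - Fb) * (Real.log (meanEnergy h a / meanEnergy h b) / Real.log 2)) := by
      rw [Real.one_le_sqrt, ← mul_div_assoc]
      exact (one_le_div hl2).2 hm
    rw [← add_div, hg, add_sub_cancel, show Fb - FB + (Fa - Fb) = Fa - FB by ring,
      ← mul_div_assoc, ← mul_div_assoc, ← hg, ← mul_div_assoc] at S
    rw [← mul_div_assoc] at S1
    push_cast
    linarith

theorem log_two_le_annealingScale {n : ℕ} (hΩ : 2 ≤ Fintype.card Ω) (hn : 2 ≤ n) :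
    Real.log 2 ≤ annealingScale Ω n := by
  have h1 := Real.log_le_log two_pos (by exact_mod_cast hΩ : (2 : ℝ) ≤ Fintype.card Ω)
  have h2 := Real.log_le_log two_pos (by exact_mod_cast hn : (2 : ℝ) ≤ n)
  have := Real.log_pos one_lt_two
  exact Real.le_sqrt_of_sq_le (by nlinarith)

/-- A cooling schedule of length `O(√(ln |Ω| ln n))` with constant overlaps. -/
theorem exists_schedule {n : ℕ} (H : Ω → Fin (n + 1)) {B : ℝ} (hΩ : 2 ≤ Fintype.card Ω)
    (hn : 2 ≤ n) (hB : 0 < B) :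
    ∃ (l : ℕ) (β : Fin (l + 1) → ℝ), StrictMono β ∧ β 0 = 0 ∧ β (Fin.last l) = B ∧
      (l : ℝ) ≤ 8 * annealingScale Ω n ∧
      ∀ i : Fin l, 1 / 2 ≤ ‖inner ℂ (qsample (intGibbs H (β i.castSucc)))
        (qsample (intGibbs H (β i.succ)))‖ ^ 2 := by
  have : Nonempty Ω := Fintype.card_pos_iff.1 (by omega)
  obtain ⟨x₀, hx₀⟩ := Finite.exists_min H
  -- Energies are measured from the ground state. This leaves the Gibbs distributions unchanged and
  -- gives `Z ≥ 1` and a unit spectral gap above `0`.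
  set h : Ω → ℝ := fun x => ((H x : ℕ) : ℝ) - ((H x₀ : ℕ) : ℝ) with hh
  have h01 : ∀ x, h x = 0 ∨ 1 ≤ h x := by
    intro x
    rcases (show (H x₀ : ℕ) ≤ H x from hx₀ x).eq_or_lt with e | e
    · left; simp [hh, e]
    · right
      have : ((H x₀ : ℕ) : ℝ) + 1 ≤ ((H x : ℕ) : ℝ) := by exact_mod_cast e
      simp only [hh]; linarith
  have hle : ∀ x, h x ≤ n := by
    intro x
    have h1 : ((H x : ℕ) : ℝ) ≤ n := by exact_mod_cast Nat.lt_succ_iff.1 (H x).2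
    have h2 : (0 : ℝ) ≤ ((H x₀ : ℕ) : ℝ) := Nat.cast_nonneg _
    simp only [hh]; linarith
  have hl2 : 0 < Real.log 2 := Real.log_pos one_lt_two
  obtain ⟨k, hk⟩ := exists_nat_gt
    ((Real.log (partitionFunction h 0) - Real.log (partitionFunction h B)) / Real.log 2)
  obtain ⟨l, β, h1, h2, h3, h4, h5⟩ := exists_schedule_from h01 B k 0 hB ((div_lt_iff₀ hl2).1 hk)
  refine ⟨l, β, h1, h2, h3, ?_, fun i => ?_⟩
  · have hZ0 : partitionFunction h 0 = Fintype.card Ω := by simp [partitionFunction]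
    have hZB : 0 ≤ Real.log (partitionFunction h B) := by
      apply Real.log_nonneg
      have := Finset.single_le_sum (f := fun x => Real.exp (-B * h x))
        (fun x _ => (Real.exp_pos _).le) (Finset.mem_univ x₀)
      simpa [hh, partitionFunction] using this
    have hE : meanEnergy h 0 ≤ n := by
      calc meanEnergy h 0 ≤ ∑ x, gibbs h 0 x * n :=
            Finset.sum_le_sum fun x _ => mul_le_mul_of_nonneg_left (hle x) (gibbs_pos h 0 x).le
        _ = n := by rw [← Finset.sum_mul, sum_gibbs, one_mul]
    have hn' : (2 : ℝ) ≤ n := by exact_mod_cast hn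
    have hlogn : Real.log 2 ≤ Real.log n := Real.log_le_log two_pos hn'
    have hA0 : 0 ≤ Real.log (Fintype.card Ω) := Real.log_natCast_nonneg _
    have hsc := log_two_le_annealingScale hΩ hn
    have l2 := Real.log_two_gt_d9
    have hG : Real.log (4 * meanEnergy h 0) ≤ 3 * Real.log n := by
      rcases le_or_gt (meanEnergy h 0) 0 with hneg | hpos
      · have h0 : ∀ x, 0 ≤ h x := fun x => (h01 x).elim (fun e => e.ge) (by intro; linarith)
        have : meanEnergy h 0 = 0 := le_antisymm hneg
          (Finset.sum_nonneg fun x _ => mul_nonneg (gibbs_pos h 0 x).le (h0 x))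
        -- For constant `H` the logarithm takes its default value `0`.
        rw [this, mul_zero, Real.log_zero]; linarith
      -- `4n ≤ n ^ 3` since `n ≥ 2`.
      · calc _ ≤ Real.log ((n : ℝ) ^ 3) := by
              refine Real.log_le_log (by linarith) ?_
              nlinarith [mul_nonneg (show (0 : ℝ) ≤ n by linarith)
                (show (0 : ℝ) ≤ n ^ 2 - 4 by nlinarith)]
          _ = _ := by rw [Real.log_pow]; push_cast; ring
    have hs : √((Real.log (partitionFunction h 0) - Real.log (partitionFunction h B)) *
        Real.log (4 * meanEnergy h 0) / Real.log 2) ≤ 3 * annealingScale Ω n := by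
      have hF : Real.log (partitionFunction h B) ≤ Real.log (partitionFunction h 0) := by
        refine Real.log_le_log (partitionFunction_pos h B) (partitionFunction_antitone
          (fun x => (h01 x).elim (fun e => e.ge) (by intro; linarith)) hB.le)
      rw [annealingScale, show (3 : ℝ) = √(3 ^ 2) by simp, ← Real.sqrt_mul (by norm_num)]
      apply Real.sqrt_le_sqrt
      rw [div_le_iff₀ hl2]
      calc _ ≤ (Real.log (partitionFunction h 0) - Real.log (partitionFunction h B)) *
            (3 * Real.log n) := mul_le_mul_of_nonneg_left hG (by linarith)
        _ ≤ Real.log (Fintype.card Ω) * (3 * Real.log n) :=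
            mul_le_mul_of_nonneg_right (by rw [hZ0]; linarith) (by linarith)
        _ ≤ _ := by nlinarith [mul_nonneg hA0 (hl2.le.trans hlogn)]
    -- The additive `2` is at most `5` times the annealing scale, which is at least `log 2`; this
    -- gives `8 = 3 + 5`.
    linarith
  · have e : ∀ b, intGibbs H b = gibbs h b := fun b => (gibbs_sub_const _ _ b).symm
    rw [e, e, norm_inner_qsample_gibbs_sq]
    calc (1 / 2 : ℝ) = Real.exp (-Real.log 2) := by
          rw [Real.exp_neg, Real.exp_log two_pos]; norm_num
      _ ≤ _ := Real.exp_le_exp.2 (neg_le_neg (h4 i))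

end Schedule

/-! ### Unitary matrices: fixed-point amplification and eigenvectors -/

section LinearAlgebra

open Matrix

variable {ι : Type*} [Fintype ι] [DecidableEq ι]

theorem toEuclideanLin_mul_apply {κ μ : Type*} [Fintype κ] [DecidableEq κ] (A : Matrix μ ι ℂ)
    (B : Matrix ι κ ℂ) (v : EuclideanSpace ℂ κ) :
    toEuclideanLin (A * B) v = toEuclideanLin A (toEuclideanLin B v) := by
  ext i
  simp

theorem toEuclideanLin_one_apply (v : EuclideanSpace ℂ ι) :
    toEuclideanLin (1 : Matrix ι ι ℂ) v = v := by
  ext i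
  simp

theorem inner_toEuclideanLin {κ : Type*} [Fintype κ] [DecidableEq κ] (A : Matrix ι κ ℂ)
    (v : EuclideanSpace ℂ κ) (w : EuclideanSpace ℂ ι) :
    inner ℂ (toEuclideanLin A v) w = inner ℂ v (toEuclideanLin Aᴴ w) := by
  rw [Matrix.toEuclideanLin_conjTranspose_eq_adjoint, LinearMap.adjoint_inner_right]

theorem conjTranspose_apply_apply {A : Matrix ι ι ℂ} (hA : A ∈ unitaryGroup ι ℂ)
    (v : EuclideanSpace ℂ ι) : toEuclideanLin Aᴴ (toEuclideanLin A v) = v := by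
  rw [← toEuclideanLin_mul_apply, ← star_eq_conjTranspose, mem_unitaryGroup_iff'.1 hA,
    toEuclideanLin_one_apply]

theorem apply_conjTranspose_apply {A : Matrix ι ι ℂ} (hA : A ∈ unitaryGroup ι ℂ)
    (v : EuclideanSpace ℂ ι) : toEuclideanLin A (toEuclideanLin Aᴴ v) = v := by
  rw [← toEuclideanLin_mul_apply, ← star_eq_conjTranspose, mem_unitaryGroup_iff.1 hA,
    toEuclideanLin_one_apply]

theorem inner_apply_apply {A : Matrix ι ι ℂ} (hA : A ∈ unitaryGroup ι ℂ)
    (v w : EuclideanSpace ℂ ι) :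
    inner ℂ (toEuclideanLin A v) (toEuclideanLin A w) = inner ℂ v w := by
  rw [inner_toEuclideanLin, conjTranspose_apply_apply hA]

theorem norm_apply {A : Matrix ι ι ℂ} (hA : A ∈ unitaryGroup ι ℂ) (v : EuclideanSpace ℂ ι) :
    ‖toEuclideanLin A v‖ = ‖v‖ := by
  rw [← sq_eq_sq₀ (norm_nonneg _) (norm_nonneg _), ← inner_self_eq_norm_sq (𝕜 := ℂ),
    ← inner_self_eq_norm_sq (𝕜 := ℂ), inner_apply_apply hA]

theorem conjTranspose_mem_unitaryGroup {A : Matrix ι ι ℂ} (hA : A ∈ unitaryGroup ι ℂ) :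
    Aᴴ ∈ unitaryGroup ι ℂ := Unitary.star_mem hA

/-! ### Fixed-point amplification -/

/-- The phase `exp(iπ/3)`. -/
noncomputable def sixthRoot : ℂ := ⟨1 / 2, √3 / 2⟩

theorem sixthRoot_sq : sixthRoot ^ 2 = sixthRoot - 1 := by
  have h3 : √3 * √3 = 3 := Real.mul_self_sqrt (by norm_num)
  apply Complex.ext
  · simp only [sixthRoot, sq, Complex.mul_re, Complex.sub_re, Complex.one_re]
    nlinarith
  · simp only [sixthRoot, sq, Complex.mul_im, Complex.sub_im, Complex.one_im]
    ring

theorem conj_mul_sixthRoot : star sixthRoot * sixthRoot = 1 := by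
  have h3 : √3 * √3 = 3 := Real.mul_self_sqrt (by norm_num)
  apply Complex.ext
  · simp [sixthRoot, Complex.mul_re]
    nlinarith
  · simp [sixthRoot, Complex.mul_im]
    ring

theorem norm_sixthRoot : ‖sixthRoot‖ = 1 := by
  have := congrArg norm conj_mul_sixthRoot
  rw [norm_mul, norm_star, norm_one] at this
  nlinarith [norm_nonneg sixthRoot]

theorem norm_one_sub_sixthRoot : ‖1 - sixthRoot‖ = 1 := by
  have : (1 - sixthRoot) * (1 - sixthRoot) = -sixthRoot := by
    linear_combination sixthRoot_sq
  have := congrArg norm this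
  rw [norm_mul, norm_neg, norm_sixthRoot] at this
  nlinarith [norm_nonneg (1 - sixthRoot)]

/-- The selective phase shift by `exp(iπ/3)` of the vector `v`. -/
noncomputable def phaseShift (v : EuclideanSpace ℂ ι) : Matrix ι ι ℂ :=
  1 - (1 - sixthRoot) • vecMulVec v (star v)

theorem phaseShift_apply (v x : EuclideanSpace ℂ ι) :
    toEuclideanLin (phaseShift v) x = x - ((1 - sixthRoot) * inner ℂ v x) • v := by
  ext i
  simp only [phaseShift, map_sub, map_smul, LinearMap.sub_apply, LinearMap.smul_apply,
    toEuclideanLin_one_apply, PiLp.sub_apply, PiLp.smul_apply, smul_eq_mul,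
    ofLp_toLpLin, toLin'_apply, Matrix.vecMulVec_mulVec, EuclideanSpace.inner_eq_star_dotProduct]
  simp [dotProduct_comm]
  ring

theorem phaseShift_mem_unitaryGroup {v : EuclideanSpace ℂ ι} (hv : ‖v‖ = 1) :
    phaseShift v ∈ unitaryGroup ι ℂ := by
  rw [mem_unitaryGroup_iff, star_eq_conjTranspose]
  have h1 : star (v : ι → ℂ) ⬝ᵥ (v : ι → ℂ) = 1 := by
    have := inner_self_eq_norm_sq_to_K (𝕜 := ℂ) v
    rw [EuclideanSpace.inner_eq_star_dotProduct, hv] at this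
    rw [dotProduct_comm]
    simpa using this
  have hsq : vecMulVec (v : ι → ℂ) (star v) * vecMulVec (v : ι → ℂ) (star v) =
      vecMulVec (v : ι → ℂ) (star v) := by
    rw [vecMulVec_mul_vecMulVec, h1]
    simp
  have hH : (vecMulVec (v : ι → ℂ) (star v))ᴴ = vecMulVec (v : ι → ℂ) (star v) := by
    rw [conjTranspose_vecMulVec, star_star]
  rw [phaseShift, conjTranspose_sub, conjTranspose_one, conjTranspose_smul, hH, sub_mul, mul_sub,
    mul_sub, one_mul, one_mul, mul_one, smul_mul_smul_comm, hsq]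
  have : (1 - sixthRoot) * star (1 - sixthRoot) = (1 - sixthRoot) + star (1 - sixthRoot) := by
    simp only [star_sub, star_one]
    linear_combination conj_mul_sixthRoot
  rw [this, add_smul]
  abel

/-- One round of fixed-point amplification. -/
def amplify (Rs Rt U : Matrix ι ι ℂ) : Matrix ι ι ℂ := U * Rs * Uᴴ * Rt * U

theorem amplify_mem_unitaryGroup {Rs Rt U : Matrix ι ι ℂ} (hs : Rs ∈ unitaryGroup ι ℂ)
    (ht : Rt ∈ unitaryGroup ι ℂ) (hU : U ∈ unitaryGroup ι ℂ) :
    amplify Rs Rt U ∈ unitaryGroup ι ℂ :=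
  mul_mem (mul_mem (mul_mem (mul_mem hU hs) (conjTranspose_mem_unitaryGroup hU)) ht) hU

theorem iterate_amplify_mem_unitaryGroup {Rs Rt U : Matrix ι ι ℂ} (hs : Rs ∈ unitaryGroup ι ℂ)
    (ht : Rt ∈ unitaryGroup ι ℂ) (hU : U ∈ unitaryGroup ι ℂ) (k : ℕ) :
    (amplify Rs Rt)^[k] U ∈ unitaryGroup ι ℂ := by
  induction k with
  | zero => exact hU
  | succ k ih =>
    rw [Function.iterate_succ_apply']
    exact amplify_mem_unitaryGroup hs ht ih

theorem norm_sub_inner_smul_sq {κ : Type*} [Fintype κ] {t : EuclideanSpace ℂ κ} (ht : ‖t‖ = 1)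
    (a : EuclideanSpace ℂ κ) :
    ‖a - (inner ℂ t a : ℂ) • t‖ ^ 2 = ‖a‖ ^ 2 - ‖(inner ℂ t a : ℂ)‖ ^ 2 := by
  rw [@norm_sub_sq ℂ, norm_smul, ht, inner_smul_right, ← inner_conj_symm a t, Complex.mul_conj]
  rw [Complex.normSq_eq_norm_sq]
  simp only [mul_one, RCLike.re_to_complex, Complex.ofReal_re]
  ring

/-- Put `a = U s`, `α = ⟨t, a⟩` and `ω = sixthRoot`. Because `ω² = ω - 1`, the amplified operator
sends `s` to `ω (1 - |α|²) a - (1 - ω) α t`. Off `t` this is `ω (1 - |α|²)` times `a - α t`, and `1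
- |α|²` is the squared norm of `a - α t`. -/
theorem norm_amplify {s t : EuclideanSpace ℂ ι} (hs : ‖s‖ = 1) (ht : ‖t‖ = 1)
    {U : Matrix ι ι ℂ} (hU : U ∈ unitaryGroup ι ℂ) :
    ‖toEuclideanLin (amplify (phaseShift s) (phaseShift t) U) s -
        (inner ℂ t (toEuclideanLin (amplify (phaseShift s) (phaseShift t) U) s) : ℂ) • t‖ =
      ‖toEuclideanLin U s - (inner ℂ t (toEuclideanLin U s) : ℂ) • t‖ ^ 3 := by
  set a := toEuclideanLin U s with ha
  set α : ℂ := inner ℂ t a with hα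
  have hα2 : inner ℂ s (toEuclideanLin Uᴴ t) = star α := by
    rw [← inner_toEuclideanLin, hα, ← inner_conj_symm]
    rfl
  have hss : (inner ℂ s s : ℂ) = 1 := by rw [inner_self_eq_norm_sq_to_K, hs]; norm_num
  have htt : (inner ℂ t t : ℂ) = 1 := by rw [inner_self_eq_norm_sq_to_K, ht]; norm_num
  have hV : toEuclideanLin (amplify (phaseShift s) (phaseShift t) U) s =
      (sixthRoot * (1 - star α * α)) • a - ((1 - sixthRoot) * α) • t := by
    simp only [amplify, toEuclideanLin_mul_apply, ← ha, phaseShift_apply]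
    simp only [← hα, map_sub, map_smul, apply_conjTranspose_apply hU, inner_sub_right,
      inner_smul_right, hα2, ← ha]
    rw [ha, conjTranspose_apply_apply hU, hss, ← ha]
    have e : (1 - sixthRoot) * (1 - (1 - sixthRoot) * α * star α) =
        1 - sixthRoot * (1 - star α * α) := by
      linear_combination (-α * star α) * sixthRoot_sq
    rw [e, sub_smul, one_smul]
    abel
  have hr := norm_sub_inner_smul_sq ht a
  rw [← hα, ha, norm_apply hU, hs, ← ha] at hr
  have hp : (1 - star α * α : ℂ) = ((‖a - α • t‖ ^ 2 : ℝ) : ℂ) := by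
    rw [hr]
    have : star α * α = ((‖α‖ ^ 2 : ℝ) : ℂ) := by
      rw [← Complex.normSq_eq_norm_sq, ← Complex.mul_conj, mul_comm]; rfl
    rw [this]; push_cast; ring
  have hfin : (sixthRoot * (1 - star α * α)) • a - ((1 - sixthRoot) * α) • t -
      (inner ℂ t ((sixthRoot * (1 - star α * α)) • a - ((1 - sixthRoot) * α) • t) : ℂ) • t =
      (sixthRoot * (1 - star α * α)) • (a - α • t) := by
    rw [inner_sub_right, inner_smul_right, inner_smul_right, htt, ← hα, smul_sub]
    module
  rw [hV, hfin, norm_smul, norm_mul, norm_sixthRoot, hp, Complex.norm_real, norm_pow, norm_norm]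
  ring

theorem norm_iterate_amplify {s t : EuclideanSpace ℂ ι} (hs : ‖s‖ = 1) (ht : ‖t‖ = 1)
    {U : Matrix ι ι ℂ} (hU : U ∈ unitaryGroup ι ℂ) (k : ℕ) :
    ‖toEuclideanLin ((amplify (phaseShift s) (phaseShift t))^[k] U) s -
        (inner ℂ t (toEuclideanLin ((amplify (phaseShift s) (phaseShift t))^[k] U) s) : ℂ) • t‖ =
      ‖toEuclideanLin U s - (inner ℂ t (toEuclideanLin U s) : ℂ) • t‖ ^ 3 ^ k := by
  induction k with
  | zero => simp
  | succ k ih =>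
    rw [Function.iterate_succ_apply', norm_amplify hs ht (iterate_amplify_mem_unitaryGroup
      (phaseShift_mem_unitaryGroup hs) (phaseShift_mem_unitaryGroup ht) hU k), ih, ← pow_mul,
      pow_succ]

/-! ### Eigenvectors of unitary matrices -/

/-- A unitary maps a finite-dimensional invariant subspace onto itself, hence preserves its
orthogonal complement. -/
theorem isSemisimple_of_mem_unitaryGroup {W : Matrix ι ι ℂ} (hW : W ∈ unitaryGroup ι ℂ) :
    Module.End.IsSemisimple (toEuclideanLin W : Module.End ℂ (EuclideanSpace ℂ ι)) := by
  rw [Module.End.isSemisimple_iff]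
  intro p hp
  refine ⟨pᗮ, ?_, p.isCompl_orthogonal⟩
  have hinj : Function.Injective ((toEuclideanLin W).restrict hp) := by
    intro x y hxy
    have h1 : toEuclideanLin W x = toEuclideanLin W y := congrArg Subtype.val hxy
    have h2 := congrArg (toEuclideanLin Wᴴ) h1
    rw [conjTranspose_apply_apply hW, conjTranspose_apply_apply hW] at h2
    exact Subtype.ext h2
  have hsurj := LinearMap.injective_iff_surjective.1 hinj
  intro x hx
  rw [Submodule.mem_comap, Submodule.mem_orthogonal]
  intro u hu
  obtain ⟨u', hu'⟩ := hsurj ⟨u, hu⟩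
  have h1 : toEuclideanLin W u' = u := congrArg Subtype.val hu'
  rw [← h1, inner_apply_apply hW]
  exact (Submodule.mem_orthogonal _ _).1 hx _ u'.2

theorem norm_eq_one_of_eigenvector {W : Matrix ι ι ℂ} (hW : W ∈ unitaryGroup ι ℂ) {z : ℂ}
    {e : EuclideanSpace ℂ ι} (he : e ≠ 0) (h : toEuclideanLin W e = z • e) : ‖z‖ = 1 := by
  have := norm_apply hW e
  rw [h, norm_smul] at this
  exact mul_right_cancel₀ (norm_ne_zero_iff.2 he) (by rw [this, one_mul])

theorem orthogonalFamily_eigenspace_of_mem_unitaryGroup {W : Matrix ι ι ℂ}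
    (hW : W ∈ unitaryGroup ι ℂ) :
    OrthogonalFamily ℂ
      (fun z => Module.End.eigenspace (toEuclideanLin W : Module.End ℂ (EuclideanSpace ℂ ι)) z)
      fun z => (Module.End.eigenspace (toEuclideanLin W : Module.End ℂ _) z).subtypeₗᵢ := by
  refine OrthogonalFamily.of_pairwise fun z w hzw x hx y hy => ?_
  rw [Module.End.mem_eigenspace_iff] at hx hy
  by_contra hne
  rw [← inner_eq_zero_symm] at hne
  have hx0 : x ≠ 0 := by rintro rfl; simp at hne
  have hz := norm_eq_one_of_eigenvector hW hx0 hx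
  have h1 := inner_apply_apply hW x y
  rw [hx, hy, inner_smul_left, inner_smul_right, ← mul_assoc] at h1
  have h2 : (starRingEnd ℂ) z * w = 1 := mul_right_cancel₀ hne (by rw [h1, one_mul])
  have h3 : z * (starRingEnd ℂ) z = 1 := by
    rw [Complex.mul_conj, Complex.normSq_eq_norm_sq, hz]; norm_num
  exact hzw (by linear_combination w * h3 - z * h2)

/-- A linear map that is diagonal in the eigenvectors of a unitary `W`, with small entries off the
eigenvalue `1`, is small on the complement of the fixed vectors of `W`. -/
theorem norm_le_of_diagonal_on_eigenvectors {W : Matrix ι ι ℂ} (hW : W ∈ unitaryGroup ι ℂ)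
    (L : EuclideanSpace ℂ ι →ₗ[ℂ] EuclideanSpace ℂ ι) (p : ℂ → ℂ) {δ : ℝ} (hδ : 0 ≤ δ)
    (hL : ∀ z e, e ≠ 0 → toEuclideanLin W e = z • e → L e = p z • e)
    (hp : ∀ z e, e ≠ 0 → toEuclideanLin W e = z • e → z ≠ 1 → ‖p z‖ ≤ δ)
    {v : EuclideanSpace ℂ ι} (hv : ∀ e, toEuclideanLin W e = e → inner ℂ e v = 0) :
    ‖L v‖ ≤ δ * ‖v‖ := by
  have hO := orthogonalFamily_eigenspace_of_mem_unitaryGroup hW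
  have htop := (isSemisimple_of_mem_unitaryGroup hW).iSup_eigenspace_eq_top
  obtain ⟨f, hf, hsum⟩ := (Submodule.mem_iSup_iff_exists_finsupp _ v).1
    (htop ▸ Submodule.mem_top : v ∈ ⨆ z, _)
  have hfe : ∀ z, toEuclideanLin W (f z) = z • f z := fun z =>
    Module.End.mem_eigenspace_iff.1 (hf z)
  have hv' : ∑ z ∈ f.support, f z = v := hsum
  have e1 : ‖v‖ ^ 2 = ∑ z ∈ f.support, ‖f z‖ ^ 2 := by
    rw [← hv']
    exact hO.norm_sum (fun z => ⟨f z, hf z⟩) f.support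
  have hLf : ∀ z, L (f z) = p z • f z := by
    intro z
    by_cases h : f z = 0
    · simp [h]
    · exact hL z _ h (hfe z)
  have e2 : ‖L v‖ ^ 2 = ∑ z ∈ f.support, ‖p z • f z‖ ^ 2 := by
    rw [← hv', map_sum]
    simp only [hLf]
    exact hO.norm_sum (fun z => ⟨p z • f z, Submodule.smul_mem _ _ (hf z)⟩) f.support
  -- The component at eigenvalue `1` is a fixed vector, and its inner product with `v` is its own
  -- squared norm.
  have h1 : f 1 = 0 := by
    have h := hv (f 1) (by simpa using hfe 1)
    rw [← hv', inner_sum] at h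
    by_contra hne
    rw [Finset.sum_eq_single (1 : ℂ)] at h
    · exact hne (inner_self_eq_zero.1 h)
    · intro z _ hz
      exact hO hz.symm ⟨f 1, hf 1⟩ ⟨f z, hf z⟩
    · intro hh
      simp [Finsupp.notMem_support_iff.1 hh]
  rw [← abs_of_nonneg (norm_nonneg (L v)), ← abs_of_nonneg (mul_nonneg hδ (norm_nonneg v)),
    ← sq_le_sq, mul_pow, e1, e2, Finset.mul_sum]
  refine Finset.sum_le_sum fun z hz => ?_
  have hne := Finsupp.mem_support_iff.1 hz
  have hz1 : z ≠ 1 := by rintro rfl; exact hne h1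
  rw [norm_smul, mul_pow]
  gcongr
  exact hp z _ hne (hfe z) hz1

end LinearAlgebra

/-! ### A qubit filter that singles out the eigenvalue 1 -/

section Filter

open Matrix

/-- Rotation of the qubit by the angle `θ`. -/
noncomputable def rotation (θ : ℝ) : Matrix (Fin 2) (Fin 2) ℂ :=
  !![(Real.cos θ : ℂ), -(Real.sin θ : ℂ); (Real.sin θ : ℂ), (Real.cos θ : ℂ)]

theorem rotation_mul (a b : ℝ) : rotation a * rotation b = rotation (a + b) := by
  ext i j
  fin_cases i <;> fin_cases j <;>
    simp [rotation, Matrix.mul_apply, Fin.sum_univ_two, Complex.cos_add, Complex.sin_add] <;> ring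

theorem rotation_zero : rotation 0 = 1 := by
  ext i j
  fin_cases i <;> fin_cases j <;> simp [rotation]

theorem rotation_pow (a : ℝ) (k : ℕ) : rotation a ^ k = rotation (k * a) := by
  induction k with
  | zero => simp [rotation_zero]
  | succ k ih => rw [pow_succ, ih, rotation_mul]; push_cast; ring_nf

theorem rotation_mem_unitaryGroup (a : ℝ) : rotation a ∈ unitaryGroup (Fin 2) ℂ := by
  have h : star (rotation a) = rotation (-a) := by
    ext i j
    fin_cases i <;> fin_cases j <;> simp [rotation, star_apply, ← Complex.cos_conj,
      ← Complex.sin_conj]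
  rw [mem_unitaryGroup_iff, h, rotation_mul, add_neg_cancel, rotation_zero]

theorem diagonal_mem_unitaryGroup {z : ℂ} (hz : ‖z‖ = 1) :
    diagonal ![1, z] ∈ unitaryGroup (Fin 2) ℂ := by
  have h : z * star z = 1 := by
    have := Complex.mul_conj z
    rw [Complex.normSq_eq_norm_sq, hz] at this
    simpa using this
  rw [mem_unitaryGroup_iff, star_eq_conjTranspose, diagonal_conjTranspose, diagonal_mul_diagonal,
    ← diagonal_one]
  congr 1
  funext i
  fin_cases i
  · simp
  · simpa using h

/-- The qubit operator produced by `K` rounds of slow rotation and controlled phases `z`, followed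
by the rotation that undoes the slow rotation when `z = 1`. -/
noncomputable def rabiFilter (K : ℕ) (z : ℂ) : Matrix (Fin 2) (Fin 2) ℂ :=
  rotation (-(Real.pi / 2)) * (rotation (Real.pi / (2 * K)) * diagonal ![1, z]) ^ K

theorem rabiFilter_mem_unitaryGroup (K : ℕ) {z : ℂ} (hz : ‖z‖ = 1) :
    rabiFilter K z ∈ unitaryGroup (Fin 2) ℂ :=
  mul_mem (rotation_mem_unitaryGroup _)
    (pow_mem (mul_mem (rotation_mem_unitaryGroup _) (diagonal_mem_unitaryGroup hz)) K)

theorem rabiFilter_one {K : ℕ} (hK : K ≠ 0) : rabiFilter K 1 = 1 := by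
  have h : diagonal ![(1 : ℂ), 1] = 1 := by
    rw [← diagonal_one]
    congr 1
    funext i
    fin_cases i <;> rfl
  have hK' : (K : ℝ) ≠ 0 := Nat.cast_ne_zero.2 hK
  rw [rabiFilter, h, mul_one, rotation_pow, rotation_mul,
    show -(Real.pi / 2) + K * (Real.pi / (2 * K)) = 0 by field_simp; ring, rotation_zero]

theorem norm_row_sq {N : Matrix (Fin 2) (Fin 2) ℂ} (hN : N ∈ unitaryGroup (Fin 2) ℂ) (i : Fin 2) :
    ‖N i 0‖ ^ 2 + ‖N i 1‖ ^ 2 = 1 := by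
  have h := congrFun (congrFun (mem_unitaryGroup_iff.1 hN) i) i
  rw [Matrix.mul_apply, Fin.sum_univ_two, star_apply, star_apply, one_apply_eq] at h
  rw [← Complex.normSq_eq_norm_sq, ← Complex.normSq_eq_norm_sq]
  have : ((Complex.normSq (N i 0) + Complex.normSq (N i 1) : ℝ) : ℂ) = 1 := by
    push_cast
    rw [← Complex.mul_conj, ← Complex.mul_conj]
    exact h
  exact_mod_cast this

theorem norm_col_sq {N : Matrix (Fin 2) (Fin 2) ℂ} (hN : N ∈ unitaryGroup (Fin 2) ℂ) (i : Fin 2) :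
    ‖N 0 i‖ ^ 2 + ‖N 1 i‖ ^ 2 = 1 := by
  have h := norm_row_sq (conjTranspose_mem_unitaryGroup hN) i
  simpa [conjTranspose_apply] using h

/-- Off resonance the slow rotation is ineffective. -/
theorem norm_rabiFilter_le {K : ℕ} {z : ℂ} (hz : ‖z‖ = 1)
    (h : 2 * Real.sin (Real.pi / (2 * K)) ≤ Real.cos (Real.pi / (2 * K)) * ‖1 - z‖)
    (hs : 0 ≤ Real.sin (Real.pi / (2 * K))) (hc : 0 < Real.cos (Real.pi / (2 * K)))
    (hz1 : z ≠ 1) : ‖rabiFilter K z 0 0‖ ≤ √(1 / 2) := by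
  set M := rotation (Real.pi / (2 * K)) * diagonal ![1, z] with hM
  set N := M ^ K with hNdef
  have hMu : M ∈ unitaryGroup (Fin 2) ℂ :=
    mul_mem (rotation_mem_unitaryGroup _) (diagonal_mem_unitaryGroup hz)
  have hN : N ∈ unitaryGroup (Fin 2) ℂ := pow_mem hMu K
  -- The last quarter turn exchanges the roles of `|0⟩` and `|1⟩`, so this entry is the amplitude
  -- that the slow rotation managed to transfer.
  have h00 : rabiFilter K z 0 0 = N 1 0 := by
    rw [rabiFilter, ← hM, ← hNdef, Matrix.mul_apply, Fin.sum_univ_two]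
    simp [rotation]
  -- The off-diagonal entry of `N M = M N` controls the power `N` without diagonalising `M`.
  have hcomm : N * M = M * N := (Commute.refl M).pow_left K
  have e := congrFun (congrFun hcomm 1) 0
  rw [Matrix.mul_apply, Matrix.mul_apply, Fin.sum_univ_two, Fin.sum_univ_two] at e
  have m00 : M 0 0 = (Real.cos (Real.pi / (2 * K)) : ℂ) := by
    rw [hM, mul_diagonal]; simp [rotation]
  have m10 : M 1 0 = (Real.sin (Real.pi / (2 * K)) : ℂ) := by
    rw [hM, mul_diagonal]; simp [rotation]
  have m11 : M 1 1 = (Real.cos (Real.pi / (2 * K)) : ℂ) * z := by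
    rw [hM, mul_diagonal]; simp [rotation]
  rw [m00, m10, m11] at e
  set c := Real.cos (Real.pi / (2 * K))
  set s := Real.sin (Real.pi / (2 * K))
  have e2 : N 1 0 * ((c : ℂ) * (1 - z)) = (s : ℂ) * (N 0 0 - N 1 1) := by linear_combination e
  have e3 := congrArg norm e2
  rw [norm_mul, norm_mul, norm_mul, Complex.norm_real, Complex.norm_real, Real.norm_of_nonneg hs,
    Real.norm_of_nonneg hc.le] at e3
  have e4 := norm_sub_le (N 0 0) (N 1 1)
  have c0 := norm_col_sq hN 0
  have r1 := norm_row_sq hN 1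
  have e5 : ‖N 0 0‖ = ‖N 1 1‖ := by
    rw [← sq_eq_sq₀ (norm_nonneg _) (norm_nonneg _)]; linarith
  have hpos : 0 < c * ‖1 - z‖ := mul_pos hc (norm_pos_iff.2 (sub_ne_zero.2 hz1.symm))
  have e6 : ‖N 1 0‖ ≤ ‖N 0 0‖ := by
    have : ‖N 1 0‖ * (c * ‖1 - z‖) ≤ ‖N 0 0‖ * (c * ‖1 - z‖) := by
      rw [e3]
      calc s * ‖N 0 0 - N 1 1‖ ≤ s * (2 * ‖N 0 0‖) :=
            mul_le_mul_of_nonneg_left (by linarith) hs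
        _ = ‖N 0 0‖ * (2 * s) := by ring
        _ ≤ _ := mul_le_mul_of_nonneg_left h (norm_nonneg _)
    exact le_of_mul_le_mul_right this hpos
  rw [h00]
  apply Real.le_sqrt_of_sq_le
  nlinarith [norm_nonneg (N 1 0)]

/-- The filter on the qubit: amplified suppression of all phases `z` away from `1`. -/
noncomputable def phaseFilter (K k : ℕ) (z : ℂ) : Matrix (Fin 2) (Fin 2) ℂ :=
  (amplify (phaseShift (EuclideanSpace.single 0 1)) (phaseShift (EuclideanSpace.single 1 1)))^[k]
    (rabiFilter K z)

theorem phaseFilter_mem_unitaryGroup (K k : ℕ) {z : ℂ} (hz : ‖z‖ = 1) :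
    phaseFilter K k z ∈ unitaryGroup (Fin 2) ℂ :=
  iterate_amplify_mem_unitaryGroup (phaseShift_mem_unitaryGroup (by simp))
    (phaseShift_mem_unitaryGroup (by simp)) (rabiFilter_mem_unitaryGroup K hz) k

/-- The amplification has source `|0⟩` and target `|1⟩`, so the norm that it cubes is that of the
entry at `(0, 0)`. -/
theorem norm_phaseFilter (K k : ℕ) {z : ℂ} (hz : ‖z‖ = 1) :
    ‖phaseFilter K k z 0 0‖ = ‖rabiFilter K z 0 0‖ ^ 3 ^ k := by
  have key : ∀ V : Matrix (Fin 2) (Fin 2) ℂ,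
      ‖toEuclideanLin V (EuclideanSpace.single 0 1) - (inner ℂ (EuclideanSpace.single (1 : Fin 2) 1)
        (toEuclideanLin V (EuclideanSpace.single 0 1)) : ℂ) • EuclideanSpace.single 1 1‖ =
      ‖V 0 0‖ := by
    intro V
    have : toEuclideanLin V (EuclideanSpace.single 0 1) -
        (inner ℂ (EuclideanSpace.single (1 : Fin 2) (1 : ℂ))
        (toEuclideanLin V (EuclideanSpace.single 0 1)) : ℂ) • EuclideanSpace.single 1 1 =
        EuclideanSpace.single 0 (V 0 0) := by
      ext i
      fin_cases i <;> simp [EuclideanSpace.inner_single_left]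
    rw [this, PiLp.norm_single]
  rw [← key, ← key]
  exact norm_iterate_amplify (by simp) (by simp) (rabiFilter_mem_unitaryGroup K hz) k

theorem norm_phaseFilter_one {K : ℕ} (hK : K ≠ 0) (k : ℕ) : ‖phaseFilter K k 1 0 0‖ = 1 := by
  rw [norm_phaseFilter K k (by simp), rabiFilter_one hK]
  simp

/-- At eigenvalue `1` the entry at `(0, 0)` has modulus one and exhausts its column, so the filter
has no leakage there. -/
theorem phaseFilter_one_one_zero {K : ℕ} (hK : K ≠ 0) (k : ℕ) : phaseFilter K k 1 1 0 = 0 := by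
  have h := norm_col_sq (phaseFilter_mem_unitaryGroup K k (z := 1) (by simp)) 0
  rw [norm_phaseFilter_one hK] at h
  have : ‖phaseFilter K k 1 1 0‖ ^ 2 = 0 := by linarith
  simpa using this

/-- The number of slow rotations that resolves a phase gap `Δ`. -/
noncomputable def filterLength (Δ : ℝ) : ℕ := ⌈10 / Δ⌉₊ + 2

theorem norm_phaseFilter_le {Δ : ℝ} (hΔ : 0 < Δ) (k : ℕ) {z : ℂ} (hz : ‖z‖ = 1) (hz1 : z ≠ 1)
    (h : 2 / Real.pi * Δ ≤ ‖1 - z‖) :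
    ‖phaseFilter (filterLength Δ) k z 0 0‖ ≤ √(1 / 2) ^ 3 ^ k := by
  rw [norm_phaseFilter _ _ hz]
  refine pow_le_pow_left₀ (norm_nonneg _) ?_ _
  set K := filterLength Δ with hKdef
  have hK1 : 10 / Δ ≤ K := by
    rw [hKdef, filterLength]; push_cast
    linarith [Nat.le_ceil (10 / Δ)]
  have hK2 : (2 : ℝ) ≤ K := by
    rw [hKdef, filterLength]; push_cast
    have : (0 : ℝ) ≤ (⌈10 / Δ⌉₊ : ℝ) := Nat.cast_nonneg _
    linarith
  have hpi := Real.pi_pos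
  have hpi4 := Real.pi_lt_d2
  have hx0 : 0 ≤ Real.pi / (2 * K) := by positivity
  have hx1 : Real.pi / (2 * K) ≤ Real.pi / 4 := by
    apply div_le_div_of_nonneg_left hpi.le (by norm_num); linarith
  have hx2 : Real.pi / (2 * K) ≤ Real.pi * Δ / 20 := by
    rw [div_le_iff₀ hΔ] at hK1
    rw [div_le_div_iff₀ (by linarith) (by norm_num)]
    nlinarith
  have hsin := Real.sin_le hx0
  have hcos : 7 / 10 ≤ Real.cos (Real.pi / (2 * K)) := by
    have h1 := Real.cos_le_cos_of_nonneg_of_le_pi hx0 (by linarith) hx1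
    rw [Real.cos_pi_div_four] at h1
    have : (1.4 : ℝ) ≤ √2 := Real.le_sqrt_of_sq_le (by norm_num)
    linarith
  refine norm_rabiFilter_le hz ?_
    (Real.sin_nonneg_of_nonneg_of_le_pi hx0 (by linarith)) (by linarith) hz1
  have h2 : 0.63 * Δ ≤ ‖1 - z‖ := by
    refine le_trans ?_ h
    apply mul_le_mul_of_nonneg_right _ hΔ.le
    rw [le_div_iff₀ hpi]
    linarith
  -- At least `10 / Δ` rotations put the left side below `0.32 Δ`, against `0.44 Δ` on the right,
  -- where `0.63 < 2 / π`. The extra two rotations in `filterLength` keep the angle below `π / 4`,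
  -- hence the cosine above `0.7`.
  calc 2 * Real.sin (Real.pi / (2 * K)) ≤ 2 * (Real.pi * Δ / 20) := by linarith
    _ ≤ 7 / 10 * (0.63 * Δ) := by nlinarith
    _ ≤ _ := mul_le_mul hcos h2 (by positivity) (by linarith)

end Filter

/-! ### The Szegedy walk: fixed vectors and phase gap -/

section Walk

open Matrix

variable {Ω : Type*} [Fintype Ω] [DecidableEq Ω]

theorem stepIsometry_apply (P : Matrix Ω Ω ℝ) (ψ : EuclideanSpace ℂ Ω) (p : Ω × Ω) :
    toEuclideanLin (stepIsometry P) ψ p = (√(P p.1 p.2) : ℝ) * ψ p.1 := by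
  simp [stepIsometry, Matrix.mulVec, dotProduct]

theorem swapMatrix_apply (u : EuclideanSpace ℂ (Ω × Ω)) (p : Ω × Ω) :
    toEuclideanLin (swapMatrix Ω) u p = u p.swap := by
  have h : ∀ q : Ω × Ω, p = q.swap ↔ q = p.swap := fun q =>
    ⟨fun h => by rw [h, Prod.swap_swap], fun h => by rw [h, Prod.swap_swap]⟩
  simp [swapMatrix, Matrix.mulVec, dotProduct, h]

theorem swapMatrix_conjTranspose {Ω : Type*} [DecidableEq Ω] :
    (swapMatrix Ω)ᴴ = swapMatrix Ω := by
  ext p q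
  have h : q = p.swap ↔ p = q.swap :=
    ⟨fun h => by rw [h, Prod.swap_swap], fun h => by rw [h, Prod.swap_swap]⟩
  simp [swapMatrix, conjTranspose_apply, h]

theorem swapMatrix_mul_self : swapMatrix Ω * swapMatrix Ω = 1 := by
  ext p q
  simp [swapMatrix, Matrix.mul_apply, one_apply]

theorem swapMatrix_mem_unitaryGroup : swapMatrix Ω ∈ unitaryGroup (Ω × Ω) ℂ := by
  rw [mem_unitaryGroup_iff, star_eq_conjTranspose, swapMatrix_conjTranspose, swapMatrix_mul_self]

theorem stepIsometry_conjTranspose_mul_self {P : Matrix Ω Ω ℝ}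
    (hP : P ∈ Matrix.rowStochastic ℝ Ω) : (stepIsometry P)ᴴ * stepIsometry P = 1 := by
  have h1 := (Matrix.mem_rowStochastic_iff_sum.1 hP).2
  have h0 := (Matrix.mem_rowStochastic_iff_sum.1 hP).1
  ext x y
  rw [Matrix.mul_apply, Fintype.sum_prod_type]
  simp only [stepIsometry, conjTranspose_apply, of_apply]
  by_cases hxy : x = y
  · subst hxy
    rw [Finset.sum_eq_single x]
    · simp only [if_true, one_apply_eq, RCLike.star_def, Complex.conj_ofReal, ← Complex.ofReal_mul,
        Real.mul_self_sqrt (h0 _ _), ← Complex.ofReal_sum, h1]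
      simp
    · intro z _ hz
      simp [hz]
    · simp
  · rw [one_apply_ne hxy]
    refine Finset.sum_eq_zero fun z _ => Finset.sum_eq_zero fun w _ => ?_
    by_cases hz : z = x
    · subst hz; simp [hxy]
    · simp [hz]

theorem norm_stepIsometry {P : Matrix Ω Ω ℝ} (hP : P ∈ Matrix.rowStochastic ℝ Ω)
    (ψ : EuclideanSpace ℂ Ω) : ‖toEuclideanLin (stepIsometry P) ψ‖ = ‖ψ‖ := by
  rw [← sq_eq_sq₀ (norm_nonneg _) (norm_nonneg _), ← inner_self_eq_norm_sq (𝕜 := ℂ),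
    ← inner_self_eq_norm_sq (𝕜 := ℂ), inner_toEuclideanLin, ← toEuclideanLin_mul_apply,
    stepIsometry_conjTranspose_mul_self hP, toEuclideanLin_one_apply]

theorem szegedyWalk_mem_unitaryGroup {P : Matrix Ω Ω ℝ} (hP : P ∈ Matrix.rowStochastic ℝ Ω) :
    szegedyWalk P ∈ unitaryGroup (Ω × Ω) ℂ := by
  refine mul_mem ?_ swapMatrix_mem_unitaryGroup
  have hT := stepIsometry_conjTranspose_mul_self hP
  set T := stepIsometry P
  have hsq : T * Tᴴ * (T * Tᴴ) = T * Tᴴ := by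
    rw [Matrix.mul_assoc, ← Matrix.mul_assoc Tᴴ, hT, Matrix.one_mul]
  rw [mem_unitaryGroup_iff, star_eq_conjTranspose, conjTranspose_sub, conjTranspose_smul,
    conjTranspose_mul, conjTranspose_conjTranspose, conjTranspose_one, sub_mul, mul_sub, mul_sub,
    one_mul, one_mul, mul_one, smul_mul_smul_comm, hsq]
  simp only [star_ofNat]
  module

variable {P : Matrix Ω Ω ℝ} {π : Ω → ℝ}

theorem norm_qsample {Ω : Type*} [Fintype Ω] {π : Ω → ℝ} (h0 : ∀ x, 0 ≤ π x)
    (h1 : ∑ x, π x = 1) : ‖qsample π‖ = 1 := by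
  have : ‖qsample π‖ ^ 2 = 1 := by
    rw [EuclideanSpace.norm_sq_eq, ← h1]
    refine Finset.sum_congr rfl fun x _ => ?_
    simp [qsample, Real.sq_sqrt (h0 x)]
  nlinarith [norm_nonneg (qsample π)]

theorem szegedyWalk_apply (P : Matrix Ω Ω ℝ) (u : EuclideanSpace ℂ (Ω × Ω)) :
    toEuclideanLin (szegedyWalk P) u =
      (2 : ℂ) • toEuclideanLin (stepIsometry P) (toEuclideanLin (stepIsometry P)ᴴ
        (toEuclideanLin (swapMatrix Ω) u)) - toEuclideanLin (swapMatrix Ω) u := by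
  rw [szegedyWalk, toEuclideanLin_mul_apply, map_sub, map_smul, LinearMap.sub_apply,
    LinearMap.smul_apply, toEuclideanLin_one_apply, toEuclideanLin_mul_apply]

/-- Detailed balance says that `T|π⟩` is symmetric under the swap, and the reflection fixes the
range of `T`. -/
theorem szegedyWalk_stepIsometry_qsample (hP : IsReversibleChain P π) :
    toEuclideanLin (szegedyWalk P) (toEuclideanLin (stepIsometry P) (qsample π)) =
      toEuclideanLin (stepIsometry P) (qsample π) := by
  have hS : toEuclideanLin (swapMatrix Ω) (toEuclideanLin (stepIsometry P) (qsample π)) =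
      toEuclideanLin (stepIsometry P) (qsample π) := by
    ext p
    rw [swapMatrix_apply, stepIsometry_apply, stepIsometry_apply]
    simp only [qsample, Prod.fst_swap, Prod.snd_swap, ← Complex.ofReal_mul]
    have hn := (Matrix.mem_rowStochastic_iff_sum.1 hP.stochastic).1
    rw [← Real.sqrt_mul (hn _ _), ← Real.sqrt_mul (hn _ _), mul_comm, hP.detailed_balance, mul_comm]
  rw [szegedyWalk_apply, hS, ← toEuclideanLin_mul_apply (stepIsometry P)ᴴ,
    stepIsometry_conjTranspose_mul_self hP.stochastic, toEuclideanLin_one_apply]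
  module

/-- Let `w = T†u`. Applying `T†` to `W u = u` gives `T†S u = w`, hence `u + S u = 2 T w`, so `T w`
is swap-symmetric. With detailed balance, `w / √π` is constant along edges of the chain, and
irreducibility makes it constant. -/
theorem stepIsometry_conjTranspose_fixed (hP : IsReversibleChain P π) (h0 : ∀ x, 0 < π x)
    {u : EuclideanSpace ℂ (Ω × Ω)} (hu : toEuclideanLin (szegedyWalk P) u = u) :
    ∃ c : ℂ, toEuclideanLin (stepIsometry P)ᴴ u = c • qsample π := by
  have hT := stepIsometry_conjTranspose_mul_self hP.stochastic
  have hn := (Matrix.mem_rowStochastic_iff_sum.1 hP.stochastic).1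
  set w := toEuclideanLin (stepIsometry P)ᴴ u with hw
  rw [szegedyWalk_apply] at hu
  have h1 : toEuclideanLin (stepIsometry P)ᴴ (toEuclideanLin (swapMatrix Ω) u) = w := by
    have h := congrArg (toEuclideanLin (stepIsometry P)ᴴ) hu
    rw [map_sub, map_smul, ← toEuclideanLin_mul_apply (stepIsometry P)ᴴ, hT,
      toEuclideanLin_one_apply, two_smul, add_sub_cancel_right] at h
    exact h
  rw [h1] at hu
  -- Swap symmetry of `T w`, from the fixed-point equation at `(x, y)` and at `(y, x)`.
  have h2 : ∀ x y, (√(P x y) : ℂ) * w x = (√(P y x) : ℂ) * w y := by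
    intro x y
    have e1 := congrArg (fun v => v (x, y)) hu
    have e2 := congrArg (fun v => v (y, x)) hu
    simp only [PiLp.sub_apply, PiLp.smul_apply, smul_eq_mul, stepIsometry_apply,
      swapMatrix_apply, Prod.swap_prod_mk] at e1 e2
    linear_combination (e1 - e2) / 2
  have hq : ∀ x, (√(π x) : ℂ) ≠ 0 := fun x =>
    Complex.ofReal_ne_zero.2 (Real.sqrt_pos.2 (h0 x)).ne'
  have h3 : ∀ x y, 0 < P x y → w y / (√(π y) : ℂ) = w x / (√(π x) : ℂ) := by
    intro x y hxy
    rw [div_eq_div_iff (hq _) (hq _)]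
    have hs : (√(P x y) : ℂ) ≠ 0 := Complex.ofReal_ne_zero.2 (Real.sqrt_pos.2 hxy).ne'
    have e : (√(π x) : ℂ) * (√(P x y) : ℂ) = (√(π y) : ℂ) * (√(P y x) : ℂ) := by
      rw [← Complex.ofReal_mul, ← Complex.ofReal_mul, ← Real.sqrt_mul (h0 _).le,
        ← Real.sqrt_mul (h0 _).le, hP.detailed_balance]
    apply mul_left_cancel₀ hs
    linear_combination w y * e - (√(π y) : ℂ) * h2 x y
  rcases isEmpty_or_nonempty Ω with hE | ⟨⟨x₀⟩⟩
  · exact ⟨0, by ext x; exact hE.elim x⟩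
  have h4 : ∀ y, w y / (√(π y) : ℂ) = w x₀ / (√(π x₀) : ℂ) := by
    intro y
    let _ := Matrix.toQuiver P
    obtain ⟨p, -⟩ := hP.irreducible.connected x₀ y
    induction p with
    | nil => rfl
    | cons p e ih => rw [h3 _ _ e.down, ih]
  refine ⟨w x₀ / (√(π x₀) : ℂ), ?_⟩
  ext y
  rw [PiLp.smul_apply, smul_eq_mul, ← h4 y]
  simp [qsample, div_mul_cancel₀ _ (hq y)]

/-- The fixed space of `W` may be larger than the line of `T|π⟩`, but only its image under `T†`
matters, and that image lies in the line of `|π⟩`. -/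
theorem inner_fixed_stepIsometry (hP : IsReversibleChain P π) (h0 : ∀ x, 0 < π x)
    {u : EuclideanSpace ℂ (Ω × Ω)} (hu : toEuclideanLin (szegedyWalk P) u = u)
    {ψ : EuclideanSpace ℂ Ω} (hψ : inner ℂ (qsample π) ψ = 0) :
    inner ℂ u (toEuclideanLin (stepIsometry P) ψ) = 0 := by
  obtain ⟨c, hc⟩ := stepIsometry_conjTranspose_fixed hP h0 hu
  rw [← inner_conj_symm, inner_toEuclideanLin, hc, inner_smul_right, ← inner_conj_symm, hψ]
  simp

theorem bddBelow_phases (P : Matrix Ω Ω ℝ) : BddBelow {r : ℝ | ∃ θ : ℝ, θ ≠ 0 ∧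
    Complex.exp (θ * Complex.I) ∈ spectrum ℂ (szegedyWalk P) ∧ r = |θ|} :=
  ⟨0, by rintro r ⟨θ, -, -, rfl⟩; exact abs_nonneg θ⟩

theorem mem_spectrum_of_eigenvector {ι : Type*} [Fintype ι] [DecidableEq ι] {W : Matrix ι ι ℂ}
    {z : ℂ} {e : EuclideanSpace ℂ ι} (he : e ≠ 0) (h : toEuclideanLin W e = z • e) :
    z ∈ spectrum ℂ W := by
  rw [← Matrix.spectrum_toLpLin 2]
  exact Module.End.HasEigenvalue.mem_spectrum (Module.End.hasEigenvalue_of_hasEigenvector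
    ⟨Module.End.mem_eigenspace_iff.2 h, he⟩)

/-- Chord against arc: `|1 - z| = 2 |sin (arg z / 2)|`, followed by Jordan's inequality. -/
theorem phaseGap_le_norm_one_sub {z : ℂ} (hz : z ∈ spectrum ℂ (szegedyWalk P)) (hz0 : ‖z‖ = 1)
    (hz1 : z ≠ 1) : 2 / Real.pi * phaseGap P ≤ ‖1 - z‖ := by
  have he : Complex.exp (z.arg * Complex.I) = z := by
    have := Complex.norm_mul_exp_arg_mul_I z
    rwa [hz0, Complex.ofReal_one, one_mul] at this
  have harg : z.arg ≠ 0 := by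
    intro h
    rw [h] at he
    exact hz1 (by simpa using he.symm)
  have h1 : phaseGap P ≤ |z.arg| := csInf_le (bddBelow_phases P) ⟨z.arg, harg, by rwa [he], rfl⟩
  have h2 : ‖1 - z‖ = 2 * |Real.sin (z.arg / 2)| := by
    rw [norm_sub_rev]
    nth_rewrite 1 [← he]
    rw [mul_comm, Complex.norm_exp_I_mul_ofReal_sub_one, norm_mul]
    simp
  have h3 := Real.mul_abs_le_abs_sin (x := z.arg / 2) (by
    rw [abs_div, abs_two]
    linarith [Complex.abs_arg_le_pi z])
  rw [abs_div, abs_two] at h3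
  have hpi := Real.pi_pos
  rw [h2]
  calc 2 / Real.pi * phaseGap P ≤ 2 / Real.pi * |z.arg| :=
        mul_le_mul_of_nonneg_left h1 (by positivity)
    _ = 2 * (2 / Real.pi * (|z.arg| / 2)) := by ring
    _ ≤ _ := by linarith

theorem one_mem_spectrum_szegedyWalk (hP : IsReversibleChain P π) (h0 : ∀ x, 0 < π x)
    (h1 : ∑ x, π x = 1) : (1 : ℂ) ∈ spectrum ℂ (szegedyWalk P) := by
  refine mem_spectrum_of_eigenvector (e := toEuclideanLin (stepIsometry P) (qsample π)) ?_ ?_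
  · rw [← norm_ne_zero_iff, norm_stepIsometry hP.stochastic, norm_qsample (fun x => (h0 x).le) h1]
    exact one_ne_zero
  · rw [one_smul, szegedyWalk_stepIsometry_qsample hP]

/-- The eigenvalue `1` is also reached by the nonzero angle `2π`. So the infimum defining the gap is
over a nonempty set and is at most `2π`, even if `W` has no other eigenvalue. -/
theorem two_pi_mem_phases (hP : IsReversibleChain P π) (h0 : ∀ x, 0 < π x) (h1 : ∑ x, π x = 1) :
    2 * Real.pi ∈ {r : ℝ | ∃ θ : ℝ, θ ≠ 0 ∧
      Complex.exp (θ * Complex.I) ∈ spectrum ℂ (szegedyWalk P) ∧ r = |θ|} := by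
  have hpi := Real.pi_pos
  refine ⟨2 * Real.pi, by positivity, ?_, (abs_of_pos (by positivity)).symm⟩
  push_cast
  rw [Complex.exp_two_pi_mul_I]
  exact one_mem_spectrum_szegedyWalk hP h0 h1

theorem phaseGap_le_two_pi (hP : IsReversibleChain P π) (h0 : ∀ x, 0 < π x)
    (h1 : ∑ x, π x = 1) : phaseGap P ≤ 2 * Real.pi :=
  csInf_le (bddBelow_phases P) (two_pi_mem_phases hP h0 h1)

/-- The spectrum is finite, so eigenvalues other than `1` stay away from `1`; nonzero angles
representing `1` itself are at least `2π` in modulus. -/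
theorem phaseGap_pos (hP : IsReversibleChain P π) (h0 : ∀ x, 0 < π x) (h1 : ∑ x, π x = 1) :
    0 < phaseGap P := by
  have hpi := Real.pi_pos
  obtain ⟨ρ, hρ, hρ'⟩ : ∃ ρ > 0, ∀ z ∈ spectrum ℂ (szegedyWalk P), z ≠ 1 → ρ ≤ ‖z - 1‖ := by
    have hfin : (spectrum ℂ (szegedyWalk P) \ {1}).Finite := (Matrix.finite_spectrum _).sdiff
    rcases (spectrum ℂ (szegedyWalk P) \ {1}).eq_empty_or_nonempty with h | h
    · refine ⟨1, one_pos, fun z hz hz1 => ?_⟩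
      have : z ∈ spectrum ℂ (szegedyWalk P) \ {1} := ⟨hz, hz1⟩
      rw [h] at this
      exact this.elim
    · obtain ⟨w, hw, hmin⟩ := Set.exists_min_image _ (fun z : ℂ => ‖z - 1‖) hfin h
      exact ⟨‖w - 1‖, norm_pos_iff.2 (sub_ne_zero.2 hw.2), fun z hz hz1 => hmin z ⟨hz, hz1⟩⟩
  refine (lt_min hρ (by positivity : 0 < 2 * Real.pi)).trans_le
    (le_csInf ⟨_, two_pi_mem_phases hP h0 h1⟩ ?_)
  rintro r ⟨θ, hθ, hspec, rfl⟩
  by_cases he : Complex.exp (θ * Complex.I) = 1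
  · obtain ⟨m, hm⟩ := Complex.exp_eq_one_iff.1 he
    have hm' : θ = m * (2 * Real.pi) := by
      have : (θ : ℂ) = m * (2 * Real.pi) :=
        mul_right_cancel₀ Complex.I_ne_zero (by rw [hm]; ring)
      exact_mod_cast this
    have hm0 : m ≠ 0 := by rintro rfl; simp at hm'; exact hθ hm'
    have : (1 : ℝ) ≤ |(m : ℝ)| := by exact_mod_cast Int.one_le_abs hm0
    rw [hm', abs_mul, abs_of_pos (by positivity : 0 < 2 * Real.pi)]
    exact (min_le_right _ _).trans (by nlinarith)
  · refine (min_le_left _ _).trans ((hρ' _ hspec he).trans ?_)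
    rw [mul_comm]
    simpa using Real.norm_exp_I_mul_ofReal_sub_one_le (x := θ)

end Walk

/-! ### Circuits, their unitaries, and the filtered walk -/

section Circuits

open Matrix

/-- The adjoint of a gate. -/
def Gate.adj {m : ℕ} : Gate m → Gate m
  | .qubit u => .qubit (star u)
  | .cswap => .cswap
  | .creflect => .creflect
  | .oracle i => .oracleAdj i
  | .oracleAdj i => .oracle i

/-- The adjoint of a circuit. -/
def Circuit.adj {m : ℕ} (c : Circuit m) : Circuit m := (c.map Gate.adj).reverse

/-- One round of fixed-point amplification of a circuit. -/
def Circuit.amplify {m : ℕ} (Rs Rt c : Circuit m) : Circuit m := c ++ Rt ++ c.adj ++ Rs ++ c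

theorem Circuit.queries_append {m : ℕ} (c d : Circuit m) :
    Circuit.queries (c ++ d) = c.queries + d.queries := by
  simp [Circuit.queries]

theorem Circuit.queries_adj {m : ℕ} (c : Circuit m) : c.adj.queries = c.queries := by
  have : Gate.queries ∘ Gate.adj = (Gate.queries : Gate m → ℕ) := by
    funext g
    cases g <;> rfl
  simp [Circuit.queries, Circuit.adj, List.sum_reverse, this]

theorem Circuit.queries_amplify {m : ℕ} (Rs Rt c : Circuit m) :
    (Circuit.amplify Rs Rt c).queries = 3 * c.queries + (Rs.queries + Rt.queries) := by
  simp only [Circuit.amplify, Circuit.queries_append, Circuit.queries_adj]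
  ring

variable {Ω : Type*} [Fintype Ω] [DecidableEq Ω] {m : ℕ} (z : Ω)
  (O : Fin m → Matrix (Ω × Ω) (Ω × Ω) ℂ)

/-- The unitary of a circuit. -/
def Circuit.toMatrix : Circuit m → Matrix (Fin 2 × Ω × Ω) (Fin 2 × Ω × Ω) ℂ
  | [] => 1
  | g :: c => Circuit.toMatrix c * Gate.toMatrix z O g

theorem Circuit.run_eq (c : Circuit m) (ψ : EuclideanSpace ℂ (Fin 2 × Ω × Ω)) :
    c.run z O ψ = toEuclideanLin (c.toMatrix z O) ψ := by
  induction c generalizing ψ with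
  | nil => rw [Circuit.toMatrix, toEuclideanLin_one_apply]; rfl
  | cons g c ih => rw [Circuit.toMatrix, toEuclideanLin_mul_apply, ← ih]; rfl

theorem Circuit.toMatrix_append (c d : Circuit m) :
    Circuit.toMatrix z O (c ++ d) = d.toMatrix z O * c.toMatrix z O := by
  induction c with
  | nil => simp [Circuit.toMatrix]
  | cons g c ih => rw [List.cons_append, Circuit.toMatrix, ih, Circuit.toMatrix, Matrix.mul_assoc]

theorem Circuit.toMatrix_singleton (g : Gate m) :
    Circuit.toMatrix z O [g] = g.toMatrix z O := by
  simp [Circuit.toMatrix]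

theorem Circuit.toMatrix_flatten_replicate (c : Circuit m) (k : ℕ) :
    Circuit.toMatrix z O (List.replicate k c).flatten = c.toMatrix z O ^ k := by
  induction k with
  | zero => rfl
  | succ k ih =>
    rw [List.replicate_succ, List.flatten_cons, Circuit.toMatrix_append, ih, pow_succ]

theorem conjTranspose_controlled (M : Matrix (Ω × Ω) (Ω × Ω) ℂ) :
    (controlled M)ᴴ = controlled Mᴴ := by
  simp [controlled, conjTranspose_kronecker]

theorem controlled_mul (A B : Matrix (Ω × Ω) (Ω × Ω) ℂ) :
    controlled A * controlled B = controlled (A * B) := by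
  simp [controlled, add_mul, mul_add, ← mul_kronecker_mul]

theorem controlled_one : controlled (1 : Matrix (Ω × Ω) (Ω × Ω) ℂ) = 1 := by
  rw [controlled, ← add_kronecker]
  have : single (0 : Fin 2) (0 : Fin 2) (1 : ℂ) + single 1 1 1 = 1 := by
    ext i j
    fin_cases i <;> fin_cases j <;> simp [single]
  rw [this, one_kronecker_one]

theorem controlled_mem_unitaryGroup {M : Matrix (Ω × Ω) (Ω × Ω) ℂ}
    (hM : M ∈ unitaryGroup (Ω × Ω) ℂ) : controlled M ∈ unitaryGroup (Fin 2 × Ω × Ω) ℂ := by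
  rw [mem_unitaryGroup_iff, star_eq_conjTranspose] at *
  rw [conjTranspose_controlled, controlled_mul, hM, controlled_one]

theorem kronecker_mem_unitaryGroup' {A : Matrix (Fin 2) (Fin 2) ℂ}
    (hA : A ∈ unitaryGroup (Fin 2) ℂ) {M : Matrix (Ω × Ω) (Ω × Ω) ℂ}
    (hM : M ∈ unitaryGroup (Ω × Ω) ℂ) : A ⊗ₖ M ∈ unitaryGroup (Fin 2 × Ω × Ω) ℂ := by
  rw [mem_unitaryGroup_iff, star_eq_conjTranspose] at *
  rw [conjTranspose_kronecker, ← mul_kronecker_mul, hA, hM, one_kronecker_one]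

theorem conjTranspose_reflectZero : (reflectZero z)ᴴ = reflectZero z := by
  simp [reflectZero, conjTranspose_kronecker]

theorem reflectZero_mul_self : reflectZero z * reflectZero z = 1 := by
  rw [reflectZero, ← mul_kronecker_mul, one_mul]
  have : ((2 : ℂ) • single z z (1 : ℂ) - 1) * ((2 : ℂ) • single z z (1 : ℂ) - 1) = 1 := by
    rw [sub_mul, mul_sub, mul_sub, one_mul, one_mul, mul_one, smul_mul_smul_comm,
      single_mul_single_same, one_mul]
    module
  rw [this, one_kronecker_one]

theorem Gate.toMatrix_adj (g : Gate m) : g.adj.toMatrix z O = (g.toMatrix z O)ᴴ := by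
  cases g with
  | qubit u => simp [Gate.adj, Gate.toMatrix, conjTranspose_kronecker, star_eq_conjTranspose]
  | cswap =>
    simp only [Gate.adj, Gate.toMatrix, conjTranspose_controlled, swapMatrix_conjTranspose]
  | creflect =>
    simp only [Gate.adj, Gate.toMatrix, conjTranspose_controlled, conjTranspose_reflectZero]
  | oracle i => simp [Gate.adj, Gate.toMatrix, conjTranspose_kronecker]
  | oracleAdj i => simp [Gate.adj, Gate.toMatrix, conjTranspose_kronecker]

theorem Circuit.toMatrix_adj (c : Circuit m) : c.adj.toMatrix z O = (c.toMatrix z O)ᴴ := by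
  induction c with
  | nil => simp [Circuit.adj, Circuit.toMatrix]
  | cons g c ih =>
    have : Circuit.adj (g :: c) = Circuit.adj c ++ [g.adj] := by simp [Circuit.adj]
    rw [this, Circuit.toMatrix_append, Circuit.toMatrix_singleton, ih, Gate.toMatrix_adj,
      Circuit.toMatrix, conjTranspose_mul]

theorem Circuit.toMatrix_amplify (Rs Rt c : Circuit m) :
    (Circuit.amplify Rs Rt c).toMatrix z O =
      QSample.amplify (Rs.toMatrix z O) (Rt.toMatrix z O) (c.toMatrix z O) := by
  simp only [Circuit.amplify, Circuit.toMatrix_append, Circuit.toMatrix_adj, QSample.amplify,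
    Matrix.mul_assoc]

theorem Circuit.toMatrix_iterate_amplify (Rs Rt c : Circuit m) (k : ℕ) :
    Circuit.toMatrix z O ((Circuit.amplify Rs Rt)^[k] c) =
      (QSample.amplify (Rs.toMatrix z O) (Rt.toMatrix z O))^[k] (c.toMatrix z O) := by
  induction k with
  | zero => rfl
  | succ k ih =>
    rw [Function.iterate_succ_apply', Function.iterate_succ_apply', Circuit.toMatrix_amplify, ih]

variable {z O}

theorem Gate.toMatrix_mem_unitaryGroup (hO : ∀ i, O i ∈ unitaryGroup (Ω × Ω) ℂ) (g : Gate m) :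
    g.toMatrix z O ∈ unitaryGroup (Fin 2 × Ω × Ω) ℂ := by
  cases g with
  | qubit u => exact kronecker_mem_unitaryGroup' u.2 (one_mem _)
  | cswap => exact controlled_mem_unitaryGroup swapMatrix_mem_unitaryGroup
  | creflect =>
    refine controlled_mem_unitaryGroup ?_
    rw [mem_unitaryGroup_iff, star_eq_conjTranspose, conjTranspose_reflectZero,
      reflectZero_mul_self]
  | oracle i => exact kronecker_mem_unitaryGroup' (one_mem _) (hO i)
  | oracleAdj i =>
    exact kronecker_mem_unitaryGroup' (one_mem _) (conjTranspose_mem_unitaryGroup (hO i))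

theorem Circuit.toMatrix_mem_unitaryGroup (hO : ∀ i, O i ∈ unitaryGroup (Ω × Ω) ℂ)
    (c : Circuit m) : c.toMatrix z O ∈ unitaryGroup (Fin 2 × Ω × Ω) ℂ := by
  induction c with
  | nil => exact one_mem _
  | cons g c ih => exact mul_mem ih (Gate.toMatrix_mem_unitaryGroup hO g)

/-! ### Product states -/

/-- The product state `q ⊗ v`. -/
noncomputable def tensor (q : EuclideanSpace ℂ (Fin 2)) :
    EuclideanSpace ℂ (Ω × Ω) →ₗ[ℂ] EuclideanSpace ℂ (Fin 2 × Ω × Ω) where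
  toFun v := WithLp.toLp 2 fun p => q p.1 * v p.2
  map_add' v w := by ext p; simp [mul_add]
  map_smul' c v := by ext p; simp [mul_left_comm]

theorem tensor_apply (q : EuclideanSpace ℂ (Fin 2)) (v : EuclideanSpace ℂ (Ω × Ω))
    (p : Fin 2 × Ω × Ω) : tensor q v p = q p.1 * v p.2 := rfl

theorem norm_tensor (q : EuclideanSpace ℂ (Fin 2)) (v : EuclideanSpace ℂ (Ω × Ω)) :
    ‖tensor q v‖ = ‖q‖ * ‖v‖ := by
  rw [← sq_eq_sq₀ (norm_nonneg _) (by positivity), mul_pow, EuclideanSpace.norm_sq_eq,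
    EuclideanSpace.norm_sq_eq, EuclideanSpace.norm_sq_eq, Finset.sum_mul_sum,
    Fintype.sum_prod_type]
  simp only [tensor_apply, norm_mul, mul_pow]

theorem kronecker_tensor (A : Matrix (Fin 2) (Fin 2) ℂ) (M : Matrix (Ω × Ω) (Ω × Ω) ℂ)
    (q : EuclideanSpace ℂ (Fin 2)) (v : EuclideanSpace ℂ (Ω × Ω)) :
    toEuclideanLin (A ⊗ₖ M) (tensor q v) = tensor (toEuclideanLin A q) (toEuclideanLin M v) := by
  ext p
  rw [tensor_apply]
  simp only [ofLp_toLpLin, toLin'_apply, Matrix.mulVec, dotProduct, kroneckerMap_apply,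
    tensor_apply]
  rw [Finset.sum_mul_sum, Fintype.sum_prod_type]
  exact Finset.sum_congr rfl fun i _ => Finset.sum_congr rfl fun j _ => by ring

theorem one_kronecker_tensor (M : Matrix (Ω × Ω) (Ω × Ω) ℂ)
    (q : EuclideanSpace ℂ (Fin 2)) (v : EuclideanSpace ℂ (Ω × Ω)) :
    toEuclideanLin ((1 : Matrix (Fin 2) (Fin 2) ℂ) ⊗ₖ M) (tensor q v) =
      tensor q (toEuclideanLin M v) := by
  rw [kronecker_tensor, toEuclideanLin_one_apply]

/-- The component of a state with the qubit in `|0⟩`. -/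
noncomputable def zeroComponent :
    EuclideanSpace ℂ (Fin 2 × Ω × Ω) →ₗ[ℂ] EuclideanSpace ℂ (Ω × Ω) where
  toFun v := WithLp.toLp 2 fun p => v (0, p)
  map_add' v w := by ext p; simp
  map_smul' c v := by ext p; simp

theorem zeroComponent_tensor (q : EuclideanSpace ℂ (Fin 2)) (v : EuclideanSpace ℂ (Ω × Ω)) :
    zeroComponent (tensor q v) = q 0 • v := by
  ext p
  rfl

theorem phaseShift_kronecker_apply (y : EuclideanSpace ℂ (Fin 2 × Ω × Ω)) :
    toEuclideanLin (phaseShift (EuclideanSpace.single (0 : Fin 2) (1 : ℂ)) ⊗ₖ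
      (1 : Matrix (Ω × Ω) (Ω × Ω) ℂ)) y =
      y - (1 - sixthRoot) • tensor (EuclideanSpace.single 0 1) (zeroComponent y) := by
  have h : phaseShift (EuclideanSpace.single (0 : Fin 2) (1 : ℂ)) = diagonal ![sixthRoot, 1] := by
    ext i j
    fin_cases i <;> fin_cases j <;> simp [phaseShift, vecMulVec_apply]
  rw [h, ← diagonal_one, diagonal_kronecker_diagonal]
  ext ⟨i, p⟩
  simp only [PiLp.sub_apply, PiLp.smul_apply, tensor_apply, ofLp_toLpLin, toLin'_apply,
    mulVec_diagonal, zeroComponent, LinearMap.coe_mk, AddHom.coe_mk]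
  fin_cases i
  · simp; ring
  · simp

/-! ### Operators diagonal in the eigenvectors of the walk -/

/-- On `q ⊗ e`, with `e` an eigenvector of `W` of eigenvalue `ζ`, `M` acts as `u ζ` on `q`. -/
def ActsOnQubit (W : Matrix (Ω × Ω) (Ω × Ω) ℂ) (M : Matrix (Fin 2 × Ω × Ω) (Fin 2 × Ω × Ω) ℂ)
    (u : ℂ → Matrix (Fin 2) (Fin 2) ℂ) : Prop :=
  ∀ ζ e q, ‖ζ‖ = 1 → toEuclideanLin W e = ζ • e →
    toEuclideanLin M (tensor q e) = tensor (toEuclideanLin (u ζ) q) e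

variable {W : Matrix (Ω × Ω) (Ω × Ω) ℂ} {M N : Matrix (Fin 2 × Ω × Ω) (Fin 2 × Ω × Ω) ℂ}
  {u v : ℂ → Matrix (Fin 2) (Fin 2) ℂ}

theorem ActsOnQubit.mul (hM : ActsOnQubit W M u) (hN : ActsOnQubit W N v) :
    ActsOnQubit W (M * N) fun ζ => u ζ * v ζ := fun ζ e q hζ he => by
  rw [toEuclideanLin_mul_apply, hN ζ e q hζ he, hM ζ e _ hζ he, toEuclideanLin_mul_apply]

theorem ActsOnQubit.kronecker_one (A : Matrix (Fin 2) (Fin 2) ℂ) :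
    ActsOnQubit W (A ⊗ₖ (1 : Matrix (Ω × Ω) (Ω × Ω) ℂ)) fun _ => A := fun ζ e q _ _ => by
  rw [kronecker_tensor, toEuclideanLin_one_apply]

theorem ActsOnQubit.pow (hM : ActsOnQubit W M u) (k : ℕ) :
    ActsOnQubit W (M ^ k) fun ζ => u ζ ^ k := by
  induction k with
  | zero =>
    intro ζ e q _ _
    simp only [pow_zero, toEuclideanLin_one_apply]
  | succ k ih =>
    simp only [pow_succ]
    exact ih.mul hM

theorem ActsOnQubit.conjTranspose (hM : ActsOnQubit W M u)
    (hMu : M ∈ unitaryGroup (Fin 2 × Ω × Ω) ℂ)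
    (hu : ∀ ζ, ‖ζ‖ = 1 → u ζ ∈ unitaryGroup (Fin 2) ℂ) :
    ActsOnQubit W Mᴴ fun ζ => (u ζ)ᴴ := fun ζ e q hζ he => by
  have h := hM ζ e (toEuclideanLin (u ζ)ᴴ q) hζ he
  rw [apply_conjTranspose_apply (hu ζ hζ)] at h
  rw [← h, conjTranspose_apply_apply hMu]

/-- Reduces amplification on the full space to amplification on the qubit, separately for each
eigenvalue of the walk. -/
theorem ActsOnQubit.iterate_amplify {Rs Rt : Matrix (Fin 2 × Ω × Ω) (Fin 2 × Ω × Ω) ℂ}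
    {A B : Matrix (Fin 2) (Fin 2) ℂ} (hs : ActsOnQubit W Rs fun _ => A)
    (ht : ActsOnQubit W Rt fun _ => B) (hM : ActsOnQubit W M u)
    (hsu : Rs ∈ unitaryGroup (Fin 2 × Ω × Ω) ℂ) (htu : Rt ∈ unitaryGroup (Fin 2 × Ω × Ω) ℂ)
    (hMu : M ∈ unitaryGroup (Fin 2 × Ω × Ω) ℂ)
    (hA : A ∈ unitaryGroup (Fin 2) ℂ) (hB : B ∈ unitaryGroup (Fin 2) ℂ)
    (hu : ∀ ζ, ‖ζ‖ = 1 → u ζ ∈ unitaryGroup (Fin 2) ℂ) (k : ℕ) :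
    ActsOnQubit W ((amplify Rs Rt)^[k] M) fun ζ => (amplify A B)^[k] (u ζ) := by
  induction k with
  | zero => exact hM
  | succ k ih =>
    simp only [Function.iterate_succ_apply']
    exact (((ih.mul hs).mul (ih.conjTranspose (iterate_amplify_mem_unitaryGroup hsu htu hMu k)
      fun ζ hζ => iterate_amplify_mem_unitaryGroup hA hB (hu ζ hζ) k)).mul ht).mul ih

theorem ActsOnQubit.controlled : ActsOnQubit W (controlled W) fun ζ => diagonal ![1, ζ] := by
  intro ζ e q _ he
  rw [QSample.controlled, map_add, LinearMap.add_apply, kronecker_tensor, kronecker_tensor, he,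
    toEuclideanLin_one_apply]
  ext ⟨i, p⟩
  simp only [PiLp.add_apply, tensor_apply, PiLp.smul_apply, smul_eq_mul, ofLp_toLpLin,
    toLin'_apply, mulVec_diagonal]
  fin_cases i
  · simp [Matrix.mulVec, dotProduct, single]
  · simp [Matrix.mulVec, dotProduct, single]
    ring

/-! ### The walk from its oracle -/

/-- The embedding `|x⟩ ↦ |x⟩|0⟩`. -/
def padMatrix (z : Ω) : Matrix (Ω × Ω) Ω ℂ := of fun p x => if p = (x, z) then 1 else 0

theorem mul_padMatrix {P : Matrix Ω Ω ℝ} {Q : Matrix (Ω × Ω) (Ω × Ω) ℂ} (hQ : IsOracle P z Q) :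
    Q * padMatrix z = stepIsometry P := by
  ext ⟨x', y⟩ x
  simp [Matrix.mul_apply, padMatrix, hQ.2, stepIsometry]

theorem padMatrix_mul_conjTranspose (z : Ω) :
    padMatrix z * (padMatrix z)ᴴ = (1 : Matrix Ω Ω ℂ) ⊗ₖ single z z (1 : ℂ) := by
  ext ⟨x, y⟩ ⟨x', y'⟩
  simp only [Matrix.mul_apply, padMatrix, of_apply, conjTranspose_apply, kroneckerMap_apply,
    one_apply, single_apply, Prod.mk.injEq]
  rw [Finset.sum_eq_single x]
  · by_cases h1 : y = z <;> by_cases h2 : y' = z <;> by_cases h3 : x = x' <;>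
      simp [h1, h2, h3, eq_comm (a := z) (b := y), eq_comm (a := z) (b := y'),
        eq_comm (a := x') (b := x)]
  · intro w _ hw
    simp [hw.symm]
  · simp

/-- The oracle carries the range of `|x⟩ ↦ |x⟩|0⟩` to the range of `T`, so it conjugates one
reflection into the other, whatever it does on other basis states. -/
theorem oracle_reflectZero_oracle {P : Matrix Ω Ω ℝ} {Q : Matrix (Ω × Ω) (Ω × Ω) ℂ}
    (hQ : IsOracle P z Q) :
    Q * reflectZero z * Qᴴ = (2 : ℂ) • (stepIsometry P * (stepIsometry P)ᴴ) - 1 := by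
  have h1 : reflectZero z = (2 : ℂ) • (padMatrix z * (padMatrix z)ᴴ) - 1 := by
    rw [padMatrix_mul_conjTranspose, reflectZero, ← one_kronecker_one (m := Ω) (n := Ω)]
    ext p q
    simp only [kroneckerMap_apply, Matrix.sub_apply, Matrix.smul_apply, smul_eq_mul]
    ring
  have h2 := mem_unitaryGroup_iff.1 hQ.1
  rw [star_eq_conjTranspose] at h2
  rw [h1, mul_sub, sub_mul, mul_one, h2, mul_smul_comm, smul_mul_assoc, ← mul_padMatrix hQ,
    conjTranspose_mul]
  simp only [Matrix.mul_assoc]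

/-- The circuit of the controlled walk. -/
def walkCircuit (i : Fin m) : Circuit m := [.cswap, .oracleAdj i, .creflect, .oracle i]

/-- The oracle calls need no control: if the qubit is `|0⟩`, the reflection between them is absent
and they cancel. -/
theorem toMatrix_walkCircuit {P : Matrix Ω Ω ℝ} {i : Fin m} (hO : IsOracle P z (O i)) :
    (walkCircuit i).toMatrix z O = controlled (szegedyWalk P) := by
  have h2 := mem_unitaryGroup_iff.1 hO.1
  rw [star_eq_conjTranspose] at h2
  rw [szegedyWalk, ← controlled_mul, ← oracle_reflectZero_oracle hO]
  simp only [walkCircuit, Circuit.toMatrix, Gate.toMatrix, one_mul]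
  congr 1
  simp only [controlled, mul_add, add_mul, ← mul_kronecker_mul, mul_one, one_mul, h2]

/-- The circuit of the filter for the phases of the walk. -/
noncomputable def filterCircuit (i : Fin m) (K k : ℕ) : Circuit m :=
  (Circuit.amplify
    [.qubit ⟨_, phaseShift_mem_unitaryGroup
      (show ‖EuclideanSpace.single (0 : Fin 2) (1 : ℂ)‖ = 1 by simp)⟩]
    [.qubit ⟨_, phaseShift_mem_unitaryGroup
      (show ‖EuclideanSpace.single (1 : Fin 2) (1 : ℂ)‖ = 1 by simp)⟩])^[k]
    ((List.replicate K (walkCircuit i ++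
      [.qubit ⟨_, rotation_mem_unitaryGroup (Real.pi / (2 * K))⟩])).flatten ++
      [.qubit ⟨_, rotation_mem_unitaryGroup (-(Real.pi / 2))⟩])

theorem filterCircuit_actsOnQubit {P : Matrix Ω Ω ℝ} {i : Fin m}
    (hOu : ∀ i, O i ∈ unitaryGroup (Ω × Ω) ℂ) (hO : IsOracle P z (O i)) (K k : ℕ) :
    ActsOnQubit (szegedyWalk P) ((filterCircuit i K k).toMatrix z O) (phaseFilter K k) := by
  rw [filterCircuit, Circuit.toMatrix_iterate_amplify]
  refine ActsOnQubit.iterate_amplify ?_ ?_ ?_ (Circuit.toMatrix_mem_unitaryGroup hOu _)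
    (Circuit.toMatrix_mem_unitaryGroup hOu _) (Circuit.toMatrix_mem_unitaryGroup hOu _)
    (phaseShift_mem_unitaryGroup (by simp)) (phaseShift_mem_unitaryGroup (by simp))
    (fun ζ hζ => rabiFilter_mem_unitaryGroup K hζ) k
  · rw [Circuit.toMatrix_singleton]; exact ActsOnQubit.kronecker_one _
  · rw [Circuit.toMatrix_singleton]; exact ActsOnQubit.kronecker_one _
  · rw [Circuit.toMatrix_append, Circuit.toMatrix_flatten_replicate, Circuit.toMatrix_append,
      Circuit.toMatrix_singleton, Circuit.toMatrix_singleton, toMatrix_walkCircuit hO]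
    exact (ActsOnQubit.kronecker_one _).mul
      (((ActsOnQubit.kronecker_one _).mul ActsOnQubit.controlled).pow K)

theorem queries_filterCircuit (i : Fin m) (K k : ℕ) :
    (filterCircuit i K k).queries = 3 ^ k * (2 * K) := by
  induction k with
  | zero =>
    have : ∀ (c : Circuit m) (n : ℕ),
        Circuit.queries (List.replicate n c).flatten = n * c.queries := by
      intro c n
      induction n with
      | zero => simp [Circuit.queries]
      | succ n ih => rw [List.replicate_succ, List.flatten_cons, Circuit.queries_append, ih]; ring
    simp only [filterCircuit, Function.iterate_zero, id, Circuit.queries_append, this]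
    simp [Circuit.queries, walkCircuit, Gate.queries]
    ring
  | succ k ih =>
    rw [filterCircuit, Function.iterate_succ_apply', Circuit.queries_amplify, ← filterCircuit, ih]
    simp [Circuit.queries, Gate.queries]
    ring

end Circuits

/-! ### Approximate phase shifts and the annealing stages -/

section Annealing

open Matrix

variable {Ω : Type*} [Fintype Ω] [DecidableEq Ω] {m : ℕ} {z : Ω}
  {O : Fin m → Matrix (Ω × Ω) (Ω × Ω) ℂ}

theorem padMatrix_apply (ψ : EuclideanSpace ℂ Ω) (p : Ω × Ω) :
    toEuclideanLin (padMatrix z) ψ p = if p.2 = z then ψ p.1 else 0 := by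
  have h : ∀ x, p = (x, z) ↔ p.1 = x ∧ p.2 = z := fun x => Prod.ext_iff
  by_cases hz : p.2 = z <;> simp [padMatrix, Matrix.mulVec, dotProduct, h, hz]

theorem cleanState_eq_tensor (ψ : EuclideanSpace ℂ Ω) :
    cleanState z ψ = tensor (EuclideanSpace.single 0 1) (toEuclideanLin (padMatrix z) ψ) := by
  ext ⟨i, p⟩
  rw [tensor_apply, padMatrix_apply]
  fin_cases i <;> simp [cleanState]

theorem cleanState_sub (φ ψ : EuclideanSpace ℂ Ω) :
    cleanState z (φ - ψ) = cleanState z φ - cleanState z ψ := by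
  simp only [cleanState_eq_tensor, map_sub]

theorem cleanState_smul (c : ℂ) (ψ : EuclideanSpace ℂ Ω) :
    cleanState z (c • ψ) = c • cleanState z ψ := by
  simp only [cleanState_eq_tensor, map_smul]

theorem norm_cleanState (ψ : EuclideanSpace ℂ Ω) : ‖cleanState z ψ‖ = ‖ψ‖ := by
  rw [cleanState_eq_tensor, norm_tensor, PiLp.norm_single, norm_one, one_mul,
    ← sq_eq_sq₀ (norm_nonneg _) (norm_nonneg _), EuclideanSpace.norm_sq_eq,
    EuclideanSpace.norm_sq_eq, Fintype.sum_prod_type]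
  refine Finset.sum_congr rfl fun x _ => ?_
  rw [Finset.sum_eq_single z]
  · rw [padMatrix_apply]; simp
  · intro y _ hy
    rw [padMatrix_apply]; simp [hy]
  · simp

theorem oracle_cleanState {P : Matrix Ω Ω ℝ} {Q : Matrix (Ω × Ω) (Ω × Ω) ℂ}
    (hQ : IsOracle P z Q) (ψ : EuclideanSpace ℂ Ω) :
    toEuclideanLin ((1 : Matrix (Fin 2) (Fin 2) ℂ) ⊗ₖ Q) (cleanState z ψ) =
      tensor (EuclideanSpace.single 0 1) (toEuclideanLin (stepIsometry P) ψ) := by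
  rw [cleanState_eq_tensor, one_kronecker_tensor, ← toEuclideanLin_mul_apply, mul_padMatrix hQ]

/-! ### Approximate implementation on clean states -/

/-- `M` acts on clean states as `U` on the first register, up to the error `η`. -/
def ApproxOnClean (z : Ω) (M : Matrix (Fin 2 × Ω × Ω) (Fin 2 × Ω × Ω) ℂ) (U : Matrix Ω Ω ℂ)
    (η : ℝ) : Prop :=
  ∀ ψ, ‖toEuclideanLin M (cleanState z ψ) - cleanState z (toEuclideanLin U ψ)‖ ≤ η * ‖ψ‖

variable {M N : Matrix (Fin 2 × Ω × Ω) (Fin 2 × Ω × Ω) ℂ} {U V : Matrix Ω Ω ℂ} {η ξ : ℝ}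

theorem ApproxOnClean.one : ApproxOnClean z 1 (1 : Matrix Ω Ω ℂ) 0 := fun ψ => by
  simp only [toEuclideanLin_one_apply, sub_self, norm_zero, zero_mul, le_refl]

theorem ApproxOnClean.mul (hM : ApproxOnClean z M U η) (hN : ApproxOnClean z N V ξ)
    (hMu : M ∈ unitaryGroup (Fin 2 × Ω × Ω) ℂ) (hV : V ∈ unitaryGroup Ω ℂ) :
    ApproxOnClean z (M * N) (U * V) (η + ξ) := fun ψ => by
  have h1 := hM (toEuclideanLin V ψ)
  have h2 := hN ψ
  rw [norm_apply hV] at h1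
  rw [← norm_apply hMu, map_sub] at h2
  rw [toEuclideanLin_mul_apply, toEuclideanLin_mul_apply]
  refine (norm_sub_le_norm_sub_add_norm_sub _
    (toEuclideanLin M (cleanState z (toEuclideanLin V ψ))) _).trans ?_
  linarith

theorem ApproxOnClean.conjTranspose (hM : ApproxOnClean z M U η)
    (hMu : M ∈ unitaryGroup (Fin 2 × Ω × Ω) ℂ) (hU : U ∈ unitaryGroup Ω ℂ) :
    ApproxOnClean z Mᴴ Uᴴ η := fun ψ => by
  have h := hM (toEuclideanLin Uᴴ ψ)
  rw [apply_conjTranspose_apply hU, norm_apply (conjTranspose_mem_unitaryGroup hU),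
    ← norm_apply (conjTranspose_mem_unitaryGroup hMu), map_sub, conjTranspose_apply_apply hMu,
    norm_sub_rev] at h
  exact h

theorem ApproxOnClean.iterate_amplify {Rs Rt : Matrix (Fin 2 × Ω × Ω) (Fin 2 × Ω × Ω) ℂ}
    {A B : Matrix Ω Ω ℂ} {δ : ℝ} (hs : ApproxOnClean z Rs A δ) (ht : ApproxOnClean z Rt B δ)
    (hsu : Rs ∈ unitaryGroup (Fin 2 × Ω × Ω) ℂ) (htu : Rt ∈ unitaryGroup (Fin 2 × Ω × Ω) ℂ)
    (hA : A ∈ unitaryGroup Ω ℂ) (hB : B ∈ unitaryGroup Ω ℂ) (k : ℕ) :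
    ApproxOnClean z ((amplify Rs Rt)^[k] 1) ((amplify A B)^[k] 1) ((3 ^ k - 1) * δ) := by
  induction k with
  | zero => simpa using ApproxOnClean.one
  | succ k ih =>
    have hM := iterate_amplify_mem_unitaryGroup hsu htu (one_mem _) k
    have hU := iterate_amplify_mem_unitaryGroup hA hB (one_mem _) k
    rw [Function.iterate_succ_apply', Function.iterate_succ_apply']
    -- One round contains three copies of the previous iterate and two phase shifts, so the errors
    -- satisfy `e ↦ 3e + 2δ`, starting from `0` at the identity.
    have e : ((3 : ℝ) ^ (k + 1) - 1) * δ = (3 ^ k - 1) * δ + δ + (3 ^ k - 1) * δ + δ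
        + (3 ^ k - 1) * δ := by ring
    rw [e]
    have hM' := conjTranspose_mem_unitaryGroup hM
    exact ((((ih.mul hs hM hA).mul (ih.conjTranspose hM hU) (mul_mem hM hsu)
      (conjTranspose_mem_unitaryGroup hU)).mul ht (mul_mem (mul_mem hM hsu) hM') hB).mul ih
      (mul_mem (mul_mem (mul_mem hM hsu) hM') htu) hU)

/-! ### Approximate reflections from the walk -/

/-- The circuit of the approximate selective phase shift of a quantum sample. -/
noncomputable def phaseShiftCircuit (i : Fin m) (K k : ℕ) : Circuit m :=
  [.oracle i] ++ filterCircuit i K k ++ [.qubit ⟨_, phaseShift_mem_unitaryGroup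
      (show ‖EuclideanSpace.single (0 : Fin 2) (1 : ℂ)‖ = 1 by simp)⟩] ++
    (filterCircuit i K k).adj ++ [.oracleAdj i]

theorem queries_phaseShiftCircuit (i : Fin m) (K k : ℕ) :
    (phaseShiftCircuit i K k).queries = 3 ^ k * (4 * K) + 2 := by
  simp only [phaseShiftCircuit, Circuit.queries_append, Circuit.queries_adj, queries_filterCircuit]
  simp [Circuit.queries, Gate.queries]
  ring

theorem norm_zeroComponent_filter_le {P : Matrix Ω Ω ℝ} {π : Ω → ℝ} {Δ : ℝ} (k : ℕ)
    (hP : IsReversibleChain P π) (h0 : ∀ x, 0 < π x) (hΔ : 0 < Δ) (hΔP : Δ ≤ phaseGap P)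
    (hM : ActsOnQubit (szegedyWalk P) M (phaseFilter (filterLength Δ) k))
    {ψ : EuclideanSpace ℂ Ω} (hψ : inner ℂ (qsample π) ψ = 0) :
    ‖zeroComponent (toEuclideanLin M (tensor (EuclideanSpace.single 0 1)
      (toEuclideanLin (stepIsometry P) ψ)))‖ ≤ √(1 / 2) ^ 3 ^ k * ‖ψ‖ := by
  have hW := szegedyWalk_mem_unitaryGroup hP.stochastic
  rw [← norm_stepIsometry hP.stochastic]
  refine norm_le_of_diagonal_on_eigenvectors hW
    (zeroComponent ∘ₗ toEuclideanLin M ∘ₗ tensor (EuclideanSpace.single 0 1))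
    (fun ζ => phaseFilter (filterLength Δ) k ζ 0 0) (by positivity) ?_ ?_ ?_
  · intro ζ e hne he
    rw [LinearMap.comp_apply, LinearMap.comp_apply,
      hM ζ e _ (norm_eq_one_of_eigenvector hW hne he) he, zeroComponent_tensor]
    simp
  · intro ζ e hne he hζ
    have hn := norm_eq_one_of_eigenvector hW hne he
    refine norm_phaseFilter_le hΔ k hn hζ (le_trans ?_
      (phaseGap_le_norm_one_sub (mem_spectrum_of_eigenvector hne he) hn hζ))
    have := Real.pi_pos
    gcongr
  · intro e he
    exact inner_fixed_stepIsometry hP h0 he hψ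

/-- On `|π⟩` the filter leaves the qubit in `|0⟩` exactly, so the phase is applied and the filter is
undone. On the orthogonal complement the qubit is almost entirely in `|1⟩`, and the phase hardly
acts. -/
theorem phaseShiftCircuit_approx {P : Matrix Ω Ω ℝ} {π : Ω → ℝ} {Δ : ℝ} (k : ℕ) {i : Fin m}
    (hOu : ∀ i, O i ∈ unitaryGroup (Ω × Ω) ℂ) (hO : IsOracle P z (O i))
    (hP : IsReversibleChain P π) (h0 : ∀ x, 0 < π x) (h1 : ∑ x, π x = 1)
    (hΔ : 0 < Δ) (hΔP : Δ ≤ phaseGap P) :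
    ApproxOnClean z ((phaseShiftCircuit i (filterLength Δ) k).toMatrix z O)
      (phaseShift (qsample π)) (√(1 / 2) ^ 3 ^ k) := by
  intro ψ
  set K := filterLength Δ with hK
  have hK0 : K ≠ 0 := by simp [hK, filterLength]
  set μ := qsample π with hμ
  set B := (filterCircuit i K k).toMatrix z O with hB
  have hBu : B ∈ unitaryGroup (Fin 2 × Ω × Ω) ℂ := Circuit.toMatrix_mem_unitaryGroup hOu _
  have hact : ActsOnQubit (szegedyWalk P) B (phaseFilter K k) :=
    filterCircuit_actsOnQubit hOu hO K k
  set Q := (1 : Matrix (Fin 2) (Fin 2) ℂ) ⊗ₖ O i with hQ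
  have hQu : Q ∈ unitaryGroup (Fin 2 × Ω × Ω) ℂ := kronecker_mem_unitaryGroup' (one_mem _) (hOu i)
  have hQH : (1 : Matrix (Fin 2) (Fin 2) ℂ) ⊗ₖ (O i)ᴴ = Qᴴ := by
    rw [hQ, conjTranspose_kronecker, conjTranspose_one]
  set Φ := phaseShift (EuclideanSpace.single (0 : Fin 2) (1 : ℂ)) ⊗ₖ
    (1 : Matrix (Ω × Ω) (Ω × Ω) ℂ) with hΦ
  have hmat : (phaseShiftCircuit i K k).toMatrix z O = Qᴴ * (Bᴴ * (Φ * (B * Q))) := by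
    simp only [phaseShiftCircuit, Circuit.toMatrix_append, Circuit.toMatrix_singleton,
      Circuit.toMatrix_adj, Gate.toMatrix, hQH, ← hB, ← hQ, ← hΦ]
  set X : EuclideanSpace ℂ Ω → EuclideanSpace ℂ (Fin 2 × Ω × Ω) := fun φ =>
    toEuclideanLin B (tensor (EuclideanSpace.single 0 1) (toEuclideanLin (stepIsometry P) φ))
    with hX
  have hclean : ∀ φ, toEuclideanLin B (toEuclideanLin Q (cleanState z φ)) = X φ := fun φ => by
    rw [hQ, oracle_cleanState hO]
  have hcl : ∀ φ, cleanState z φ = toEuclideanLin Qᴴ (toEuclideanLin Bᴴ (X φ)) := fun φ => by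
    rw [← hclean, conjTranspose_apply_apply hBu, conjTranspose_apply_apply hQu]
  have hXsub : ∀ φ χ, X (φ - χ) = X φ - X χ := fun φ χ => by simp only [hX, map_sub]
  have hXsmul : ∀ (c : ℂ) φ, X (c • φ) = c • X φ := fun c φ => by simp only [hX, map_smul]
  have hXμ : tensor (EuclideanSpace.single 0 1) (zeroComponent (X μ)) = X μ := by
    simp only [hX]
    rw [hact 1 _ _ norm_one
      (by rw [hμ, szegedyWalk_stepIsometry_qsample hP, one_smul]), zeroComponent_tensor]
    have h10 : toEuclideanLin (phaseFilter K k 1) (EuclideanSpace.single (0 : Fin 2) (1 : ℂ)) =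
        phaseFilter K k 1 0 0 • EuclideanSpace.single (0 : Fin 2) (1 : ℂ) := by
      ext j
      fin_cases j
      · simp
      · simp [phaseFilter_one_one_zero hK0]
    rw [h10]
    ext ⟨j, p⟩
    simp [tensor_apply]
  have hμμ : (inner ℂ μ μ : ℂ) = 1 := by
    rw [inner_self_eq_norm_sq_to_K, hμ, norm_qsample (fun x => (h0 x).le) h1]; norm_num
  set ψ' := ψ - (inner ℂ μ ψ : ℂ) • μ with hψ'
  have hψ'0 : inner ℂ μ ψ' = 0 := by
    rw [hψ', inner_sub_right, inner_smul_right, hμμ, mul_one, sub_self]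
  -- The `μ`-part cancels exactly by `hXμ`; the remaining error is the leakage into `|0⟩` of the
  -- part orthogonal to `μ`.
  have hkey : toEuclideanLin Φ (X ψ) - X (toEuclideanLin (phaseShift μ) ψ) =
      -((1 - sixthRoot) • tensor (EuclideanSpace.single 0 1) (zeroComponent (X ψ'))) := by
    rw [hΦ, phaseShift_kronecker_apply, phaseShift_apply, hψ', hXsub, hXsub, hXsmul, hXsmul,
      map_sub, map_sub, map_smul, map_smul, hXμ]
    module
  have hn : ‖ψ'‖ ≤ ‖ψ‖ := by
    have := norm_sub_inner_smul_sq (norm_qsample (fun x => (h0 x).le) h1) ψ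
    rw [← hμ, ← hψ'] at this
    exact (sq_le_sq₀ (norm_nonneg _) (norm_nonneg _)).1 (by nlinarith [sq_nonneg ‖inner ℂ μ ψ‖])
  rw [hmat]
  simp only [toEuclideanLin_mul_apply]
  rw [hclean, hcl (toEuclideanLin (phaseShift μ) ψ), ← map_sub, ← map_sub,
    norm_apply (conjTranspose_mem_unitaryGroup hQu),
    norm_apply (conjTranspose_mem_unitaryGroup hBu), hkey, norm_neg, norm_smul,
    norm_one_sub_sixthRoot, one_mul, norm_tensor, PiLp.norm_single, norm_one, one_mul]
  exact (norm_zeroComponent_filter_le k hP h0 hΔ hΔP hact hψ'0).trans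
    (mul_le_mul_of_nonneg_left hn (by positivity))

/-! ### Annealing -/

/-- The annealing circuit of `j` stages with the given approximate phase shifts. -/
def annealCircuit (R : ℕ → Circuit m) (k : ℕ) : ℕ → Circuit m
  | 0 => []
  | j + 1 => annealCircuit R k j ++ (Circuit.amplify (R j) (R (j + 1)))^[k] []

theorem queries_annealCircuit {R : ℕ → Circuit m} {q : ℕ} (hR : ∀ j, (R j).queries = q) (k j : ℕ) :
    (annealCircuit R k j).queries ≤ j * (3 ^ k * q) := by
  -- The count satisfies `x ↦ 3x + 2q` from `0`; adding `q` makes the recursion homogeneous.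
  have h : ∀ j, ((Circuit.amplify (R j) (R (j + 1)))^[k] []).queries + q = 3 ^ k * q := by
    intro j
    induction k with
    | zero => simp [Circuit.queries]
    | succ k ih =>
      rw [Function.iterate_succ_apply', Circuit.queries_amplify, hR, hR, pow_succ]
      linarith
  induction j with
  | zero => simp [annealCircuit, Circuit.queries]
  | succ j ih =>
    rw [annealCircuit, Circuit.queries_append]
    linarith [h j]

/-- Amplification bounds only the component off the target and leaves its coefficient on the target
uncontrolled. The state is therefore tracked up to a scalar of modulus at most one, which lets the
stage errors simply add. -/
theorem annealCircuit_approx {R : ℕ → Circuit m} {s : ℕ → EuclideanSpace ℂ Ω} {k l : ℕ} {δ r : ℝ}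
    (hOu : ∀ i, O i ∈ unitaryGroup (Ω × Ω) ℂ) (hs : ∀ j, ‖s j‖ = 1)
    (hR : ∀ j, ApproxOnClean z ((R j).toMatrix z O) (phaseShift (s j)) δ)
    (hr : ∀ j < l, ‖s j - (inner ℂ (s (j + 1)) (s j) : ℂ) • s (j + 1)‖ ≤ r) :
    ∀ j ≤ l, ∃ c : ℂ, ‖c‖ ≤ 1 ∧
      ‖toEuclideanLin ((annealCircuit R k j).toMatrix z O) (cleanState z (s 0)) -
        c • cleanState z (s j)‖ ≤ j * ((3 ^ k - 1) * δ + r ^ 3 ^ k) := by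
  intro j hj
  induction j with
  | zero =>
    refine ⟨1, by simp, ?_⟩
    rw [annealCircuit, Circuit.toMatrix, toEuclideanLin_one_apply]
    simp
  | succ j ih =>
    obtain ⟨c, hc, hcj⟩ := ih (by omega)
    have hu := fun j => phaseShift_mem_unitaryGroup (hs j)
    set G := Circuit.toMatrix z O ((Circuit.amplify (R j) (R (j + 1)))^[k] []) with hG
    have hGu : G ∈ unitaryGroup (Fin 2 × Ω × Ω) ℂ := Circuit.toMatrix_mem_unitaryGroup hOu _
    set U := (amplify (phaseShift (s j)) (phaseShift (s (j + 1))))^[k] 1 with hU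
    have hUu : U ∈ unitaryGroup Ω ℂ :=
      iterate_amplify_mem_unitaryGroup (hu j) (hu (j + 1)) (one_mem _) k
    have happ : ApproxOnClean z G U ((3 ^ k - 1) * δ) := by
      rw [hG, Circuit.toMatrix_iterate_amplify]
      exact ApproxOnClean.iterate_amplify (hR j) (hR (j + 1))
        (Circuit.toMatrix_mem_unitaryGroup hOu _) (Circuit.toMatrix_mem_unitaryGroup hOu _)
        (hu j) (hu (j + 1)) k
    have hstage := norm_iterate_amplify (hs j) (hs (j + 1)) (one_mem (unitaryGroup Ω ℂ)) k
    rw [← hU, toEuclideanLin_one_apply] at hstage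
    set α : ℂ := inner ℂ (s (j + 1)) (toEuclideanLin U (s j)) with hα
    have hα1 : ‖α‖ ≤ 1 := by
      have := norm_inner_le_norm (𝕜 := ℂ) (s (j + 1)) (toEuclideanLin U (s j))
      rwa [norm_apply hUu, hs, hs, one_mul] at this
    have e1 : ‖cleanState z (toEuclideanLin U (s j)) - α • cleanState z (s (j + 1))‖ ≤
        r ^ 3 ^ k := by
      rw [← cleanState_smul, ← cleanState_sub, norm_cleanState, hstage]
      exact pow_le_pow_left₀ (norm_nonneg _) (hr j (by omega)) _
    have e2 := happ (s j)
    rw [hs, mul_one] at e2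
    have e3 : ‖toEuclideanLin G (cleanState z (s j)) - α • cleanState z (s (j + 1))‖ ≤
        (3 ^ k - 1) * δ + r ^ 3 ^ k :=
      (norm_sub_le_norm_sub_add_norm_sub _ _ _).trans (add_le_add e2 e1)
    refine ⟨c * α, ?_, ?_⟩
    · rw [norm_mul]
      exact mul_le_one₀ hc (norm_nonneg _) hα1
    · rw [annealCircuit, Circuit.toMatrix_append, toEuclideanLin_mul_apply, ← hG]
      set y := toEuclideanLin ((annealCircuit R k j).toMatrix z O) (cleanState z (s 0))
      have e4 : toEuclideanLin G y - (c * α) • cleanState z (s (j + 1)) =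
          toEuclideanLin G (y - c • cleanState z (s j)) +
            c • (toEuclideanLin G (cleanState z (s j)) - α • cleanState z (s (j + 1))) := by
        rw [map_sub, map_smul]
        module
      rw [e4]
      refine (norm_add_le _ _).trans ?_
      rw [norm_apply hGu, norm_smul]
      have e5 := mul_le_mul hc e3 (norm_nonneg _) zero_le_one
      push_cast
      linarith

/-- For unit vectors the trace distance is the distance from `y` to the line through `t`, so any
multiple of `t` bounds it. -/
theorem traceDist_le_norm_sub_smul {ι : Type*} [Fintype ι] {y t : EuclideanSpace ℂ ι}
    (hy : ‖y‖ = 1) (ht : ‖t‖ = 1) (c : ℂ) : traceDist y t ≤ ‖y - c • t‖ := by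
  rw [traceDist, ← inner_conj_symm, RCLike.norm_conj]
  apply Real.sqrt_le_iff.2 ⟨norm_nonneg _, ?_⟩
  have h1 := norm_sub_inner_smul_sq ht y
  have h2 := norm_sub_inner_smul_sq ht (y - c • t)
  have h3 : y - c • t - (inner ℂ t (y - c • t) : ℂ) • t = y - (inner ℂ t y : ℂ) • t := by
    rw [inner_sub_right, inner_smul_right, inner_self_eq_norm_sq_to_K, ht]
    simp only [RCLike.ofReal_one, one_pow, mul_one]
    module
  rw [h3, h1, hy, one_pow] at h2
  nlinarith [sq_nonneg ‖(inner ℂ t (y - c • t) : ℂ)‖]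

end Annealing

/-! ### Choice of parameters, error and query count -/

section Parameters

/-- The depth of the fixed-point amplification for `l` stages and precision `ε`. -/
noncomputable def roundCount (l : ℕ) (ε : ℝ) : ℕ :=
  ⌈Real.logb 3 (36 * Real.log (2 + l / ε))⌉₊

variable {l : ℕ} {ε : ℝ}

theorem log_two_le_log_two_add_div {x : ℝ} (hx : 0 ≤ x) (hε : 0 < ε) :
    Real.log 2 ≤ Real.log (2 + x / ε) :=
  Real.log_le_log two_pos (by have := div_nonneg hx hε.le; linarith)

theorem le_three_pow_roundCount (hε : 0 < ε) :
    36 * Real.log (2 + l / ε) ≤ 3 ^ roundCount l ε := by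
  have h1 := log_two_le_log_two_add_div (Nat.cast_nonneg l) hε
  have h2 := Real.log_two_gt_d9
  have h3 := Nat.le_ceil (Real.logb 3 (36 * Real.log (2 + l / ε)))
  rw [Real.logb_le_iff_le_rpow (by norm_num) (by linarith), Real.rpow_natCast] at h3
  exact h3

theorem three_pow_roundCount_le (hε : 0 < ε) :
    3 ^ roundCount l ε ≤ 108 * Real.log (2 + l / ε) := by
  have h1 := log_two_le_log_two_add_div (Nat.cast_nonneg l) hε
  have h2 := Real.log_two_gt_d9
  have h3 := Nat.ceil_lt_add_one
    (Real.logb_nonneg (by norm_num) (by linarith) : 0 ≤ Real.logb 3 (36 * Real.log (2 + l / ε)))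
  rw [← Real.rpow_natCast]
  calc (3 : ℝ) ^ ((roundCount l ε : ℕ) : ℝ)
      ≤ 3 ^ (Real.logb 3 (36 * Real.log (2 + l / ε)) + 1) :=
        Real.rpow_le_rpow_of_exponent_le (by norm_num) h3.le
    _ = _ := by
        rw [Real.rpow_add (by norm_num), Real.rpow_logb (by norm_num) (by norm_num) (by linarith),
          Real.rpow_one]
        ring

theorem sqrt_half_pow_le (N : ℕ) : √(1 / 2) ^ N ≤ Real.exp (-(N / 3)) := by
  have h : √(1 / 2) ≤ Real.exp (-(1 / 3)) := by
    apply Real.sqrt_le_iff.2 ⟨(Real.exp_pos _).le, ?_⟩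
    rw [← Real.exp_nat_mul, one_div, ← Real.exp_log two_pos, ← Real.exp_neg, Real.exp_le_exp]
    have := Real.log_two_gt_d9
    push_cast
    linarith
  calc √(1 / 2) ^ N ≤ Real.exp (-(1 / 3)) ^ N := pow_le_pow_left₀ (Real.sqrt_nonneg _) h N
    _ = _ := by rw [← Real.exp_nat_mul]; ring_nf

/-- With `N = 3 ^ roundCount l ε` and `Y = 2 + l / ε` the sum is `l * N * 2 ^ (-N / 2)`. Here `2 ^
(-N / 2) ≤ exp (-N / 3)` and `N ≤ 4 exp (N / 4)`, which leaves `4 exp (-N / 12)`. The constant `36 =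
12 * 3` makes this at most `4 / Y ^ 3`, while `l ≤ ε Y` and `Y ≥ 2`. -/
theorem total_error_le (hε : 0 < ε) :
    (l : ℝ) * ((3 ^ roundCount l ε - 1) * √(1 / 2) ^ 3 ^ roundCount l ε +
      √(1 / 2) ^ 3 ^ roundCount l ε) ≤ ε := by
  have hN := le_three_pow_roundCount (l := l) hε
  set N : ℕ := 3 ^ roundCount l ε with hNdef
  have hNr : (3 : ℝ) ^ roundCount l ε = N := by rw [hNdef]; push_cast; rfl
  rw [hNr] at hN ⊢
  set Y : ℝ := 2 + l / ε with hY
  have hl : (0 : ℝ) ≤ l / ε := by positivity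
  have hlY : (l : ℝ) ≤ ε * Y := by
    have : (l : ℝ) = ε * (l / ε) := by field_simp
    rw [this]
    exact mul_le_mul_of_nonneg_left (by linarith) hε.le
  have hY2 : 2 ≤ Y := by linarith
  have hN4 : (N : ℝ) ≤ 4 * Real.exp (N / 4) := by
    have := Real.add_one_le_exp ((N : ℝ) / 4)
    linarith
  have hexp : Real.exp (-(N / 12)) ≤ (Y ^ 3)⁻¹ := by
    rw [← Real.exp_log (by positivity : 0 < Y ^ 3), ← Real.exp_neg, Real.exp_le_exp, Real.log_pow]
    push_cast
    linarith
  have hbound : (N : ℝ) * √(1 / 2) ^ N ≤ 4 * (Y ^ 3)⁻¹ := by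
    calc (N : ℝ) * √(1 / 2) ^ N ≤ 4 * Real.exp (N / 4) * Real.exp (-(N / 3)) :=
          mul_le_mul hN4 (sqrt_half_pow_le N) (by positivity) (by positivity)
      _ = 4 * Real.exp (-(N / 12)) := by rw [mul_assoc, ← Real.exp_add]; ring_nf
      _ ≤ _ := by linarith
  calc (l : ℝ) * ((N - 1) * √(1 / 2) ^ N + √(1 / 2) ^ N) = l * (N * √(1 / 2) ^ N) := by ring
    _ ≤ ε * Y * (4 * (Y ^ 3)⁻¹) := mul_le_mul hlY hbound (by positivity) (by positivity)
    _ = ε * (4 / Y ^ 2) := by field_simp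
    _ ≤ ε * 1 := by
        refine mul_le_mul_of_nonneg_left ?_ hε.le
        rw [div_le_one (by positivity)]
        nlinarith
    _ = ε := mul_one ε

theorem log_two_add_div_le {s : ℝ} (hls : (l : ℝ) ≤ 8 * s) (hs : 0 ≤ s) (hε : 0 < ε) :
    Real.log (2 + l / ε) ≤ 4 * Real.log (2 + s / ε) := by
  have h0 : 0 ≤ s / ε := by positivity
  have h1 : (l : ℝ) / ε ≤ 8 * (s / ε) := by
    rw [← mul_div_assoc]
    exact div_le_div_of_nonneg_right hls hε.le
  have h2 : (4 : ℝ) * Real.log (2 + s / ε) = Real.log ((2 + s / ε) ^ 4) := by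
    rw [Real.log_pow]; norm_num
  rw [h2]
  refine Real.log_le_log (by positivity) ?_
  -- The factor `8` from the schedule length is `2 ^ 3`, absorbed into three further factors `2 + s
  -- / ε`.
  calc (2 : ℝ) + l / ε ≤ 2 ^ 3 * (2 + s / ε) := by linarith
    _ ≤ (2 + s / ε) ^ 3 * (2 + s / ε) := by gcongr; linarith
    _ = _ := by ring

theorem filterLength_le {Δ : ℝ} (hΔ : 0 < Δ) (hΔ' : Δ ≤ 2 * Real.pi) :
    (filterLength Δ : ℝ) ≤ 29 / Δ := by
  have h := Nat.ceil_lt_add_one (by positivity : 0 ≤ 10 / Δ)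
  have hpi := Real.pi_lt_d2
  -- `Δ ≤ 2π < 6.3`; this absorbs the rounding and the two extra rotations.
  have h3 : 3 ≤ 19 / Δ := by rw [le_div_iff₀ hΔ]; linarith
  have : (29 : ℝ) / Δ = 10 / Δ + 19 / Δ := by ring
  rw [filterLength]
  push_cast
  linarith

/-- The annealing circuit for `l` stages, phase gap `Δ` and precision `ε`. -/
noncomputable def annealingAlgorithm (l : ℕ) (Δ ε : ℝ) : Circuit (l + 1) :=
  annealCircuit (fun j => phaseShiftCircuit (Fin.ofNat (l + 1) j) (filterLength Δ)
    (roundCount l ε)) (roundCount l ε) l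

theorem queries_annealingAlgorithm_le {Δ s : ℝ} (hΔ : 0 < Δ) (hΔ' : Δ ≤ 2 * Real.pi)
    (hls : (l : ℝ) ≤ 8 * s) (hs : 0 ≤ s) (hε : 0 < ε) :
    ((annealingAlgorithm l Δ ε).queries : ℝ) ≤
      1000000000 * (s / Δ) * Real.log (2 + s / ε) ^ 2 := by
  have hq : (annealingAlgorithm l Δ ε).queries ≤ l * (3 ^ roundCount l ε *
      (3 ^ roundCount l ε * (4 * filterLength Δ) + 2)) :=
    queries_annealCircuit (fun j => queries_phaseShiftCircuit _ _ _) _ _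
  have hq' : ((annealingAlgorithm l Δ ε).queries : ℝ) ≤ l * (3 ^ roundCount l ε *
      (3 ^ roundCount l ε * (4 * filterLength Δ) + 2)) := by exact_mod_cast hq
  have hN := three_pow_roundCount_le (l := l) hε
  have hN1 : (1 : ℝ) ≤ 3 ^ roundCount l ε := one_le_pow₀ (by norm_num)
  set N : ℝ := 3 ^ roundCount l ε
  have hK := filterLength_le hΔ hΔ'
  have hK1 : (1 : ℝ) ≤ filterLength Δ := by
    rw [filterLength]; push_cast
    have : (0 : ℝ) ≤ (⌈10 / Δ⌉₊ : ℝ) := Nat.cast_nonneg _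
    linarith
  have hL := log_two_add_div_le hls hs hε
  have hNL : N ≤ 432 * Real.log (2 + s / ε) := by linarith
  have hNK : 1 ≤ N * filterLength Δ := one_le_mul_of_one_le_of_one_le hN1 hK1
  calc ((annealingAlgorithm l Δ ε).queries : ℝ) ≤ l * (N * (N * (4 * filterLength Δ) + 2)) := hq'
    -- The two oracle calls around the filter are absorbed using `1 ≤ N * filterLength Δ`.
    _ ≤ l * (N * (6 * (N * filterLength Δ))) := by gcongr; linarith
    _ = 6 * l * filterLength Δ * N ^ 2 := by ring
    _ ≤ 6 * (8 * s) * (29 / Δ) * (432 * Real.log (2 + s / ε)) ^ 2 := by gcongr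
    _ = (6 * 8 * 29 * 432 ^ 2) * (s / Δ) * Real.log (2 + s / ε) ^ 2 := by ring
    _ ≤ _ := by gcongr; norm_num

theorem annealingAlgorithm_traceDist_le {Ω : Type*} [Fintype Ω] [DecidableEq Ω] {z : Ω}
    {π : Fin (l + 1) → Ω → ℝ} {P : Fin (l + 1) → Matrix Ω Ω ℝ}
    {O : Fin (l + 1) → Matrix (Ω × Ω) (Ω × Ω) ℂ} {Δ : ℝ}
    (h0 : ∀ i x, 0 < π i x) (h1 : ∀ i, ∑ x, π i x = 1)
    (hπ : ∀ i : Fin l, 1 / 2 ≤ ‖inner ℂ (qsample (π i.castSucc)) (qsample (π i.succ))‖ ^ 2)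
    (hP : ∀ i, IsReversibleChain (P i) (π i)) (hO : ∀ i, IsOracle (P i) z (O i))
    (hΔ : 0 < Δ) (hΔP : ∀ i, Δ ≤ phaseGap (P i)) (hε : 0 < ε) :
    traceDist ((annealingAlgorithm l Δ ε).run z O (cleanState z (qsample (π 0))))
      (cleanState z (qsample (π (Fin.last l)))) ≤ ε := by
  have hOu : ∀ i, O i ∈ Matrix.unitaryGroup (Ω × Ω) ℂ := fun i => (hO i).1
  set s : ℕ → EuclideanSpace ℂ Ω := fun j => qsample (π (Fin.ofNat (l + 1) j)) with hs
  have hn : ∀ j, ‖s j‖ = 1 := fun j => norm_qsample (fun x => (h0 _ x).le) (h1 _)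
  have hr : ∀ j < l, ‖s j - (inner ℂ (s (j + 1)) (s j) : ℂ) • s (j + 1)‖ ≤ √(1 / 2) := by
    intro j hj
    -- `Fin.ofNat` reduces modulo `l + 1`; the stages use only indices up to `l`, so nothing wraps
    -- around.
    have e1 : Fin.ofNat (l + 1) j = (⟨j, hj⟩ : Fin l).castSucc :=
      Fin.ext (Nat.mod_eq_of_lt (by omega))
    have e2 : Fin.ofNat (l + 1) (j + 1) = (⟨j, hj⟩ : Fin l).succ :=
      Fin.ext (Nat.mod_eq_of_lt (by omega))
    have h2 := hπ ⟨j, hj⟩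
    rw [← e1, ← e2, ← inner_conj_symm, RCLike.norm_conj] at h2
    apply Real.le_sqrt_of_sq_le
    rw [norm_sub_inner_smul_sq (hn (j + 1)), hn j]
    simp only [hs]
    linarith
  obtain ⟨c, -, hc⟩ := annealCircuit_approx (k := roundCount l ε) hOu hn
    (fun j => phaseShiftCircuit_approx (roundCount l ε) hOu (hO _) (hP _) (h0 _) (h1 _) hΔ
      (hΔP (Fin.ofNat (l + 1) j))) hr l le_rfl
  have e0 : π 0 = π (Fin.ofNat (l + 1) 0) := rfl
  have el : Fin.last l = Fin.ofNat (l + 1) l := Fin.ext (Nat.mod_eq_of_lt (by omega)).symm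
  rw [Circuit.run_eq, e0, el]
  refine (traceDist_le_norm_sub_smul ?_ ?_ c).trans (hc.trans (total_error_le hε))
  · rw [norm_apply (Circuit.toMatrix_mem_unitaryGroup hOu _), norm_cleanState]
    exact hn 0
  · rw [norm_cleanState]
    exact hn l

end Parameters

end QSample

/-! ### Assembly of schedule and algorithm -/

theorem mainTheorem5 :
    -- a universal constant, and circuits that depend only on the number of stages, the minimal
    -- phase gap and the precision
    ∃ (C : ℝ) (alg : (l : ℕ) → (Δ ε : ℝ) → QSample.Circuit (l + 1)), 0 < C ∧
      ∀ (Ω : Type*) [Fintype Ω] [DecidableEq Ω] (n : ℕ) (H : Ω → Fin (n + 1)) (βt : ℝ),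
        2 ≤ Fintype.card Ω → 2 ≤ n → 0 < βt →
        -- the cooling schedule
        ∃ (l : ℕ) (β : Fin (l + 1) → ℝ),
          StrictMono β ∧ β 0 = 0 ∧ β (Fin.last l) = βt ∧
          (l : ℝ) ≤ C * QSample.annealingScale Ω n ∧
          (∀ i : Fin l, 1 / 15 ≤
            ‖inner ℂ (QSample.qsample (QSample.intGibbs H (β i.castSucc)))
              (QSample.qsample (QSample.intGibbs H (β i.succ)))‖ ^ 2) ∧
          -- the quantum algorithm
          ∀ (P : Fin (l + 1) → Matrix Ω Ω ℝ) (z : Ω)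
            (O : Fin (l + 1) → Matrix (Ω × Ω) (Ω × Ω) ℂ) (ε : ℝ),
            (∀ i, QSample.IsReversibleChain (P i) (QSample.intGibbs H (β i))) →
            (∀ i, QSample.IsOracle (P i) z (O i)) →
            0 < ε → ε < 1 →
            QSample.traceDist
                ((alg l (QSample.minPhaseGap P) ε).run z O
                  (QSample.cleanState z (QSample.qsample (QSample.intGibbs H (β 0)))))
                (QSample.cleanState z
                  (QSample.qsample (QSample.intGibbs H (β (Fin.last l))))) ≤ ε ∧
              ((alg l (QSample.minPhaseGap P) ε).queries : ℝ) ≤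
                C * (QSample.annealingScale Ω n / QSample.minPhaseGap P) *
                  Real.log (2 + QSample.annealingScale Ω n / ε) ^ 2 := by
  -- The query bound needs `6 * 8 * 29 * 432 ^ 2 < 10 ^ 9`; the schedule length needs only `8`, and
  -- its overlaps are at least `1/2`.
  refine ⟨1000000000, QSample.annealingAlgorithm, by norm_num, ?_⟩
  intro Ω _ _ n H βt hΩ hn hβt
  have : Nonempty Ω := Fintype.card_pos_iff.1 (by omega)
  have hs : 0 ≤ QSample.annealingScale Ω n := Real.sqrt_nonneg _
  obtain ⟨l, β, hmono, hβ0, hβl, hl, hov⟩ := QSample.exists_schedule H hΩ hn hβt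
  refine ⟨l, β, hmono, hβ0, hβl, hl.trans ?_, fun i => ?_, ?_⟩
  · exact mul_le_mul_of_nonneg_right (by norm_num) hs
  · exact le_trans (by norm_num) (hov i)
  intro P z O ε hP hO hε _
  have h0 : ∀ i x, 0 < QSample.intGibbs H (β i) x := fun i => QSample.gibbs_pos _ _
  have h1 : ∀ i, ∑ x, QSample.intGibbs H (β i) x = 1 := fun i => QSample.sum_gibbs _ _
  have hle : ∀ i, QSample.minPhaseGap P ≤ QSample.phaseGap (P i) :=
    fun i => ciInf_le (Set.finite_range _).bddBelow i
  have hpos : 0 < QSample.minPhaseGap P := by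
    obtain ⟨i, hi⟩ := exists_eq_ciInf_of_finite (f := fun i => QSample.phaseGap (P i))
    rw [QSample.minPhaseGap, ← hi]
    exact QSample.phaseGap_pos (hP i) (h0 i) (h1 i)
  exact ⟨QSample.annealingAlgorithm_traceDist_le (π := fun i => QSample.intGibbs H (β i))
    h0 h1 hov hP hO hpos hle hε,
    QSample.queries_annealingAlgorithm_le hpos
      ((hle 0).trans (QSample.phaseGap_le_two_pi (hP 0) (h0 0) (h1 0))) hl hs hε⟩
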